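/- Theorem. Formulae of modal dependence logic $\mathrm{MDL}$ over a set $AP$ of atomic propositions are given by $$\varphi ::= \top \mid \bot \mid q \mid \neg q \mid \mathrm{dep}(p_1,\dots,p_k;q) \mid \neg\,\mathrm{dep}(p_1,\dots,p_k;q) \mid \varphi\wedge\varphi \mid \varphi\vee\varphi \mid \varphi\ovee\varphi \mid \mathrm{AX}\,\varphi \mid \mathrm{EX}\,\varphi ,$$ with $k\ge 0$ and $p_1,\dots,p_k,q\in AP$. For a set $M$ of operators, $\mathrm{MDL}[M]$ is the set of formulae built from atomic propositions using only operators from $M$. For a Kripke structure $W=(S,R,\pi)$ with $S\neq\emptyset$, $R\subseteq S\times S$, $\pi:S\to\mathcal P(AP)$, and a team $T\subseteq S$, truth is defined by: - $W,T\models\top$ always; $W,T\models\bot$ iff $T=\emptyset$; $W,T\models p$ iff $p\in\pi(s)$ for all $s\in T$; $W,T\models\neg p$ iff $p\notin\pi(s)$ for all $s\in T$; - $W,T\models\mathrm{dep}(p_1,\dots,p_k;q)$ iff any two $s_1,s_2\in T$ with $\pi(s_1)\cap\{p_1,\dots,p_k\}=\pi(s_2)\cap\{p_1,\dots,p_k\}$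 satisfy $\pi(s_1)\cap\{q\}=\pi(s_2)\cap\{q\}$; $W,T\models\neg\,\mathrm{dep}(p_1,\dots,p_k;q)$ iff $T=\emptyset$; - $W,T\models\varphi\wedge\psi$ iff $W,T\models\varphi$ and $W,T\models\psi$; $W,T\models\varphi\ovee\psi$ iff $W,T\models\varphi$ or $W,T\models\psi$; $W,T\models\varphi\vee\psi$ iff $T=T_1\cup T_2$ for some $T_1,T_2$ with $W,T_1\models\varphi$ and $W,T_2\models\psi$; - $W,T\models\mathrm{AX}\,\varphi$ iff $W,\{s'\mid \exists s\in T:(s,s')\in R\}\models\varphi$; $W,T\models\mathrm{EX}\,\varphi$ iff $W,T'\models\varphi$ for some $T'\subseteq S$ such that every $s\in T$ has some $s'\in T'$ with $(s,s')\in R$. Let $\mathrm{MDL\text{-}MC}[M]$ be the language of all words that encode a triple $(W,T,\varphi)$ where $W$ is a finite Kripke structure (over finitely many atomic propositions), $T$ is a team of $W$, $\varphi\in\mathrm{MDL}[M]$ and $W,T\models\varphi$. Then for every $M\subseteq\{\mathrm{AX},\wedge,\neg,\mathrm{dep}\}$ the problem $\mathrm{MDL\text{-}MC}[M]$ is in $\mathrm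 P$, i.e. it is decided by a deterministic Turing machine in time polynomial in the length of the input word. -/

import Mathlib

namespace MDL

/-- Formulae of modal dependence logic over the atomic propositions `AP`.
Negation is applied to atomic propositions and to dependence atoms only. -/
inductive Formula (AP : Type*) where
  | top : Formula AP
  | bot : Formula AP
  | atom (p : AP) : Formula AP
  | negAtom (p : AP) : Formula AP
  /-- The dependence atom stating that the value of `q` is determined by the values of `ps`. -/
  | dep (ps : List AP) (q : AP) : Formula AP
  /-- The negated dependence atom. -/
  | negDep (ps : List AP) (q : AP) : Formula AP
  | and (φ ψ : Formula AP) : Formula AP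
  /-- Dependence disjunction (splitting the team). -/
  | or (φ ψ : Formula AP) : Formula AP
  /-- Classical disjunction. -/
  | cor (φ ψ : Formula AP) : Formula AP
  /-- The modality `AX`. -/
  | box (φ : Formula AP) : Formula AP
  /-- The modality `EX`. -/
  | dia (φ : Formula AP) : Formula AP

/-- The operators by which fragments of modal dependence logic are specified. -/
inductive Op where
  | AX | EX | and | or | cor | neg | top | bot | dep

/-- `φ.InFragment M`: the formula `φ` is built from atomic propositions using only
operators from `M`. -/
def Formula.InFragment {AP : Type*} (M : Set Op) : Formula AP → Prop
  | .top => Op.top ∈ M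
  | .bot => Op.bot ∈ M
  | .atom _ => True
  | .negAtom _ => Op.neg ∈ M
  | .dep _ _ => Op.dep ∈ M
  | .negDep _ _ => Op.neg ∈ M ∧ Op.dep ∈ M
  | .and φ ψ => Op.and ∈ M ∧ φ.InFragment M ∧ ψ.InFragment M
  | .or φ ψ => Op.or ∈ M ∧ φ.InFragment M ∧ ψ.InFragment M
  | .cor φ ψ => Op.cor ∈ M ∧ φ.InFragment M ∧ ψ.InFragment M
  | .box φ => Op.AX ∈ M ∧ φ.InFragment M
  | .dia φ => Op.EX ∈ M ∧ φ.InFragment M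

/-- A Kripke structure with set of worlds `S` and atomic propositions `AP`. -/
structure KripkeStructure (S AP : Type*) where
  /-- the set of worlds is non-empty -/
  nonempty : Nonempty S
  /-- the accessibility relation -/
  rel : S → S → Prop
  /-- the labeling function -/
  label : S → Set AP

/-- Team semantics: `Sat W T φ` says that `φ` is true in the team `T` of `W`. -/
def Sat {S AP : Type*} (W : KripkeStructure S AP) (T : Set S) : Formula AP → Prop
  | .top => True
  | .bot => T = ∅
  | .atom p => ∀ s ∈ T, p ∈ W.label s
  | .negAtom p => ∀ s ∈ T, p ∉ W.label s
  | .dep ps q => ∀ s₁ ∈ T, ∀ s₂ ∈ T,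
      W.label s₁ ∩ {p | p ∈ ps} ≠ W.label s₂ ∩ {p | p ∈ ps} ∨
        W.label s₁ ∩ {q} = W.label s₂ ∩ {q}
  | .negDep _ _ => T = ∅
  | .and φ ψ => Sat W T φ ∧ Sat W T ψ
  | .or φ ψ => ∃ T₁ T₂ : Set S, T = T₁ ∪ T₂ ∧ Sat W T₁ φ ∧ Sat W T₂ ψ
  | .cor φ ψ => Sat W T φ ∨ Sat W T ψ
  | .box φ => Sat W {s' | ∃ s ∈ T, W.rel s s'} φ
  | .dia φ => ∃ T' : Set S, Sat W T' φ ∧ ∀ s ∈ T, ∃ s' ∈ T', W.rel s s'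

/-- The finite alphabet in which instances of the model checking problem are written. -/
inductive Sym where
  | zero | one | sep | prop | top | bot | neg | dep | and | or | cor | box | dia
  deriving DecidableEq

instance : Fintype Sym where
  elems := {.zero, .one, .sep, .prop, .top, .bot, .neg, .dep, .and, .or, .cor, .box, .dia}
  complete x := by cases x <;> decide

open Classical in
/-- A truth value as a symbol. -/
noncomputable def bit (P : Prop) : Sym := if P then Sym.one else Sym.zero

/-- The name of the `i`-th proposition, with its index in unary. In an instance over `m`
propositions the index is less than `m`, and the instance contains a row of `m` bits for each
world, so this is polynomially equivalent to writing the index in binary. -/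
def codeProp {m : ℕ} (i : Fin m) : List Sym :=
  Sym.prop :: (List.replicate (i : ℕ) Sym.one ++ [Sym.sep])

/-- The word for the dependence atom of `ps` and `q`. -/
def codeDep {m : ℕ} (ps : List (Fin m)) (q : Fin m) : List Sym :=
  Sym.dep :: (ps.flatMap codeProp ++ Sym.sep :: codeProp q)

/-- Formulae over `m` propositions as words, in prefix (Polish) notation. -/
def Formula.code {m : ℕ} : Formula (Fin m) → List Sym
  | .top => [Sym.top]
  | .bot => [Sym.bot]
  | .atom p => codeProp p
  | .negAtom p => Sym.neg :: codeProp p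
  | .dep ps q => codeDep ps q
  | .negDep ps q => Sym.neg :: codeDep ps q
  | .and φ ψ => Sym.and :: (φ.code ++ ψ.code)
  | .or φ ψ => Sym.or :: (φ.code ++ ψ.code)
  | .cor φ ψ => Sym.cor :: (φ.code ++ ψ.code)
  | .box φ => Sym.box :: φ.code
  | .dia φ => Sym.dia :: φ.code

/-- The word for the world `i`: whether it is in the team, its row of the adjacency matrix of the
accessibility relation, and its row of the labeling matrix. -/
noncomputable def codeWorld {n m : ℕ} (W : KripkeStructure (Fin n) (Fin m)) (T : Set (Fin n))
    (i : Fin n) : List Sym :=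
  bit (i ∈ T) :: (List.ofFn (fun j : Fin n => bit (W.rel i j)) ++ Sym.sep ::
    (List.ofFn (fun p : Fin m => bit (p ∈ W.label i)) ++ [Sym.sep]))

/-- The word for the instance `(W, T, φ)`: the words for the worlds, followed by the formula. -/
noncomputable def codeInstance {n m : ℕ} (W : KripkeStructure (Fin n) (Fin m)) (T : Set (Fin n))
    (φ : Formula (Fin m)) : List Sym :=
  (List.finRange n).flatMap (codeWorld W T) ++ φ.code

/-- The model checking problem for the fragment given by `M`, as a formal language: the words
that encode `(W, T, φ)` where `W` is a (finite) Kripke structure, `T` is a team of `W`, `φ` is in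
the fragment and `φ` is true in `T`. Words that encode no instance do not belong to it. -/
def ModelChecking (M : Set Op) : Language Sym :=
  {w | ∃ (n m : ℕ) (W : KripkeStructure (Fin n) (Fin m)) (T : Set (Fin n)) (φ : Formula (Fin m)),
    φ.InFragment M ∧ Sat W T φ ∧ w = codeInstance W T φ}

open Classical in
/-- The complexity class P: the language `L` over a finite alphabet is in P if a deterministic
Turing machine decides it, on every input word, in time polynomial in the length of the word. -/
def InP {Γ : Type} [Fintype Γ] (L : Language Γ) : Prop :=
  Nonempty (Turing.TM2ComputableInPolyTime (id : List Γ → List Γ) Computability.encodeBool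
    (fun w => decide (w ∈ L)))

end MDL

/-! In the fragments at hand no operator guesses or splits a team. A conjunction is evaluated by
evaluating both conjuncts in the same team, and `AX φ` by evaluating `φ` in the one team of all
successors. Hence each subformula occurrence is evaluated in exactly one team, which is a bit vector
of length `n`. Each literal is a condition on all pairs of members of the team: the pairs that agree
on the first propositions of the atom must satisfy a condition on the last one. Plain atoms are the
case in which the condition ignores the second member.

Formulas are written in prefix notation, so a single pass with a stack of pending teams suffices.
The symbol for conjunction duplicates the top team, the symbol for `AX` replaces it by its
successors, and a literal consumes it or rejects. The invariant is `Good`: the unread input is a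
sequence of codes of formulas of the fragment, true in the pending teams one by one. It is preserved
in both directions because codes are uniquely readable (`Formula.code_append_inj`); the core of the
argument is `wp_evalFormula`. Each step is charged to the symbols it consumes, at `O((N + 1) ^ 2)`
per symbol with `N` the length of the input, so the total time is cubic.

The language also demands that malformed words be refused. A word determines its worlds, its rows
and its formula uniquely (`worldWords_append_inj`, `map_worldData_inj`), so a program that finds the
only possible decomposition unsuitable may reject.

To obtain an actual Turing machine, the algorithm is written in a small structured language of stack
programs whose cost model counts machine steps exactly. `Exec.reachesIn` shows that the compiled
machine simulates a program step for step, and `inP_of_prog` turns a polynomial bound for a program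
into membership in P. -/

open Function Turing

/-! ### Structured stack programs and their step-counting semantics. -/

namespace StackProgram

/-- How the execution of a program ends: normally, by leaving the innermost loop, or by rejecting
the input. -/
inductive Outcome
  | next | brk | rej

/-- Structured programs that operate on stacks indexed by `K`, with entries in `A`. -/
inductive Prog (K A : Type) : Type
  | push (k : K) (a : A) : Prog K A
  /-- Pop an entry, and continue according to its value. -/
  | pop (k : K) (f : Option A → Prog K A) : Prog K A
  | seq (p q : Prog K A) : Prog K A
  | loop (p : Prog K A) : Prog K A
  | exit (r : Outcome) : Prog K A

/-- Sequential composition of programs. -/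
infixr:67 " ;; " => Prog.seq

/-- Contents of the stacks. -/
abbrev Store (K A : Type) := K → List A

section Semantics

variable {K A : Type} [DecidableEq K]

/-- `Exec p S t r S'`: started on the store `S`, the program `p` ends after `t` steps with the
outcome `r` and the store `S'`. -/
inductive Exec : Prog K A → Store K A → ℕ → Outcome → Store K A → Prop
  | push (k : K) (a : A) (S : Store K A) : Exec (.push k a) S 1 .next (update S k (a :: S k))
  | pop {k : K} {f : Option A → Prog K A} {S S' : Store K A} {t : ℕ} {r : Outcome}
      (h : Exec (f (S k).head?) (update S k (S k).tail) t r S') : Exec (.pop k f) S (t + 1) r S'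
  | seq_next {p q : Prog K A} {S S₁ S' : Store K A} {t t' : ℕ} {r : Outcome}
      (h : Exec p S t .next S₁) (h' : Exec q S₁ t' r S') : Exec (p ;; q) S (t + t') r S'
  | seq_brk {p q : Prog K A} {S S' : Store K A} {t : ℕ}
      (h : Exec p S t .brk S') : Exec (p ;; q) S t .brk S'
  | seq_rej {p q : Prog K A} {S S' : Store K A} {t : ℕ}
      (h : Exec p S t .rej S') : Exec (p ;; q) S t .rej S'
  | loop_next {p : Prog K A} {S S₁ S' : Store K A} {t t' : ℕ} {r : Outcome}
      (h : Exec p S t .next S₁) (h' : Exec (.loop p) S₁ t' r S') : Exec (.loop p) S (t + t') r S'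
  | loop_brk {p : Prog K A} {S S' : Store K A} {t : ℕ}
      (h : Exec p S t .brk S') : Exec (.loop p) S t .next S'
  | loop_rej {p : Prog K A} {S S' : Store K A} {t : ℕ}
      (h : Exec p S t .rej S') : Exec (.loop p) S t .rej S'
  | exit (r : Outcome) (S : Store K A) : Exec (.exit r) S 1 r S

/-- The program `p`, started on `S`, terminates, and the number of steps, the outcome and the
final store satisfy `Q`. -/
def wp (p : Prog K A) (S : Store K A) (Q : ℕ → Outcome → Store K A → Prop) : Prop :=
  ∃ t r S', Exec p S t r S' ∧ Q t r S'

variable {p q : Prog K A} {S : Store K A} {Q Q' : ℕ → Outcome → Store K A → Prop}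

theorem wp.mono (h : wp p S Q) (hQ : ∀ t r S', Q t r S' → Q' t r S') : wp p S Q' := by
  obtain ⟨t, r, S', h, h'⟩ := h
  exact ⟨t, r, S', h, hQ _ _ _ h'⟩

theorem wp_push {k : K} {a : A} :
    wp (.push k a) S Q ↔ Q 1 .next (update S k (a :: S k)) := by
  constructor
  · rintro ⟨t, r, S', h, h'⟩
    cases h
    exact h'
  · exact fun h => ⟨_, _, _, .push k a S, h⟩

theorem wp_exit {r : Outcome} : wp (.exit r) S Q ↔ Q 1 r S := by
  constructor
  · rintro ⟨t, r, S', h, h'⟩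
    cases h
    exact h'
  · exact fun h => ⟨_, _, _, .exit r S, h⟩

theorem wp_pop {k : K} {f : Option A → Prog K A} :
    wp (.pop k f) S Q ↔
      wp (f (S k).head?) (update S k (S k).tail) (fun t => Q (t + 1)) := by
  constructor
  · rintro ⟨t, r, S', h, h'⟩
    cases h with
    | pop h => exact ⟨_, _, _, h, h'⟩
  · rintro ⟨t, r, S', h, h'⟩
    exact ⟨_, _, _, .pop h, h'⟩

/-- What has to hold after the first component of a sequential composition. -/
def seqPost (q : Prog K A) (Q : ℕ → Outcome → Store K A → Prop) :
    ℕ → Outcome → Store K A → Prop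
  | t, .next, S => wp q S (fun t' => Q (t + t'))
  | t, .brk, S => Q t .brk S
  | t, .rej, S => Q t .rej S

/-- What has to hold after one execution of the body of a loop. -/
def loopPost (p : Prog K A) (Q : ℕ → Outcome → Store K A → Prop) :
    ℕ → Outcome → Store K A → Prop
  | t, .next, S => wp (.loop p) S (fun t' => Q (t + t'))
  | t, .brk, S => Q t .next S
  | t, .rej, S => Q t .rej S

theorem wp_seq : wp (p ;; q) S Q ↔ wp p S (seqPost q Q) := by
  constructor
  · rintro ⟨t, r, S', h, h'⟩
    cases h with
    | seq_next h₁ h₂ => exact ⟨_, _, _, h₁, _, _, _, h₂, h'⟩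
    | seq_brk h₁ => exact ⟨_, _, _, h₁, h'⟩
    | seq_rej h₁ => exact ⟨_, _, _, h₁, h'⟩
  · rintro ⟨t, r, S', h, h'⟩
    cases r with
    | next =>
      obtain ⟨t', r, S'', h₂, h₃⟩ := h'
      exact ⟨_, _, _, .seq_next h h₂, h₃⟩
    | brk => exact ⟨_, _, _, .seq_brk h, h'⟩
    | rej => exact ⟨_, _, _, .seq_rej h, h'⟩

/-- One unfolding only: there is no invariant rule. Termination of each loop is shown by induction
on the data that the loop consumes. -/
theorem wp_loop : wp (.loop p) S Q ↔ wp p S (loopPost p Q) := by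
  constructor
  · rintro ⟨t, r, S', h, h'⟩
    cases h with
    | loop_next h₁ h₂ => exact ⟨_, _, _, h₁, _, _, _, h₂, h'⟩
    | loop_brk h₁ => exact ⟨_, _, _, h₁, h'⟩
    | loop_rej h₁ => exact ⟨_, _, _, h₁, h'⟩
  · rintro ⟨t, r, S', h, h'⟩
    cases r with
    | next =>
      obtain ⟨t', r, S'', h₂, h₃⟩ := h'
      exact ⟨_, _, _, .loop_next h h₂, h₃⟩
    | brk => exact ⟨_, _, _, .loop_brk h, h'⟩
    | rej => exact ⟨_, _, _, .loop_rej h, h'⟩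

/-- The additive form, with the old length on the left, avoids truncated subtraction. -/
theorem sum_length_update [Fintype K] (S : Store K A) (k : K) (l : List A) :
    ∑ i, (update S k l i).length + (S k).length = ∑ i, (S i).length + l.length := by
  rw [← Finset.add_sum_erase _ _ (Finset.mem_univ k),
    ← Finset.add_sum_erase Finset.univ (fun i => (S i).length) (Finset.mem_univ k)]
  have : ∑ i ∈ Finset.univ.erase k, (update S k l i).length =
      ∑ i ∈ Finset.univ.erase k, (S i).length :=
    Finset.sum_congr rfl fun i hi => by rw [update_of_ne (Finset.ne_of_mem_erase hi)]
  rw [this, update_self]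
  omega

/-- In each step the stacks grow by at most one entry. -/
theorem Exec.sum_length_le [Fintype K] {S S' : Store K A} {t : ℕ} {r : Outcome}
    (h : Exec p S t r S') : ∑ i, (S' i).length ≤ ∑ i, (S i).length + t := by
  induction h with
  | push k a S =>
    have := sum_length_update S k (a :: S k)
    simp only [List.length_cons] at this
    omega
  | @pop k f S S' t r h ih =>
    have := sum_length_update S k (S k).tail
    simp only [List.length_tail] at this
    omega
  | seq_next _ _ ih₁ ih₂ => omega
  | loop_next _ _ ih₁ ih₂ => omega
  | seq_brk _ ih => exact ih
  | seq_rej _ ih => exact ih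
  | loop_brk _ ih => exact ih
  | loop_rej _ ih => exact ih
  | exit => omega

end Semantics

/-! ### Compilation of programs to multi-stack Turing machines. -/

section Compiler

variable {K A : Type}

namespace Prog

/-- The labels of the Turing machine for a program. -/
def Label : Prog K A → Type
  | push _ _ => Unit
  | pop _ f => Option (Σ o, (f o).Label)
  | seq p q => p.Label ⊕ q.Label
  | loop p => p.Label
  | exit _ => Unit

/-- The label at which the execution of a program starts. -/
def start : (p : Prog K A) → p.Label
  | push _ _ => ()
  | pop _ _ => none
  | seq p _ => Sum.inl p.start
  | loop p => p.start
  | exit _ => ()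

/-- The only branching over data is at `pop`, over `Option A`, so a finite alphabet leaves finitely
many labels. -/
theorem finite_label [Finite A] : (p : Prog K A) → Finite p.Label
  | push _ _ => inferInstanceAs (Finite Unit)
  | pop _ f =>
    have := fun o => (f o).finite_label
    inferInstanceAs (Finite (Option (Σ o, (f o).Label)))
  | seq p q =>
    have := p.finite_label
    have := q.finite_label
    inferInstanceAs (Finite (p.Label ⊕ q.Label))
  | loop p => p.finite_label
  | exit _ => inferInstanceAs (Finite Unit)

/-- The stacks of the machine are those of the program, and an output stack of Booleans. -/
abbrev Entry (K A : Type) : Option K → Type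
  | none => Bool
  | some _ => A

/-- The target of a jump after the first component of a sequential composition. -/
def seqExit {Λ : Type} (l : Λ) (ex : Outcome → Λ) : Outcome → Λ
  | .next => l
  | .brk => ex .brk
  | .rej => ex .rej

/-- The target of a jump after the body of a loop. -/
def loopExit {Λ : Type} (l : Λ) (ex : Outcome → Λ) : Outcome → Λ
  | .next => l
  | .brk => ex .next
  | .rej => ex .rej

/-- The statements of the machine for a program, where `emb` embeds the labels of the program and
`ex` tells where to continue after the program. -/
def code {Λ : Type} : (p : Prog K A) → (emb : p.Label → Λ) → (ex : Outcome → Λ) → p.Label →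
    TM2.Stmt (Entry K A) Λ (Option A)
  | push k a, _, ex, _ => .push (some k) (fun _ => a) (.goto fun _ => ex .next)
  -- The popped entry is stored in the internal state and read by the jump within the same machine
  -- step, so a pop costs one step.
  | pop k f, emb, _, none =>
    .pop (some k) (fun _ o => o) (.goto fun o => emb (some ⟨o, (f o).start⟩))
  | pop _ f, emb, ex, some ⟨o, l⟩ => (f o).code (fun l => emb (some ⟨o, l⟩)) ex l
  | seq p q, emb, ex, Sum.inl l =>
    p.code (fun l => emb (Sum.inl l)) (seqExit (emb (Sum.inr q.start)) ex) l
  | seq _ q, emb, ex, Sum.inr l => q.code (fun l => emb (Sum.inr l)) ex l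
  | loop p, emb, ex, l => p.code emb (loopExit (emb p.start) ex) l
  | exit r, _, ex, _ => .goto fun _ => ex r

end Prog

/-- The stacks of the machine for a given store of the program. -/
def stackContents (S : Store K A) (out : List Bool) : (k : Option K) → List (Prog.Entry K A k)
  | none => out
  | some k => S k

theorem stackContents_update [DecidableEq K] (S : Store K A) (out : List Bool) (k : K)
    (l : List A) :
    update (stackContents S out) (some k) l = stackContents (update S k l) out := by
  funext i
  cases i with
  | none => rfl
  | some i =>
    by_cases h : i = k
    · subst h
      simp [stackContents]
    · rw [update_of_ne (by simpa using h)]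
      simp [stackContents, update_of_ne h]

theorem update_out_stackContents [DecidableEq K] (S : Store K A) (o o' : List Bool) :
    update (stackContents S o) none o' = stackContents S o' := by
  funext i
  cases i with
  | none => exact update_self (β := fun k => List (Prog.Entry K A k)) _ _ _
  | some i => exact update_of_ne (β := fun k => List (Prog.Entry K A k)) (by simp) _ _

/-- `b` is reached from `a` in `n` steps. -/
def ReachesIn {σ : Type*} (f : σ → Option σ) (n : ℕ) (a b : σ) : Prop :=
  (flip bind f)^[n] (some a) = some b

theorem ReachesIn.trans {σ : Type*} {f : σ → Option σ} {m n : ℕ} {a b c : σ}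
    (h : ReachesIn f m a b) (h' : ReachesIn f n b c) : ReachesIn f (m + n) a c := by
  unfold ReachesIn at *
  rw [add_comm, iterate_add_apply, h, h']

theorem ReachesIn.single {σ : Type*} {f : σ → Option σ} {a b : σ} (h : f a = some b) :
    ReachesIn f 1 a b := h

/-- The simulation takes exactly `t` steps: composition and looping cost nothing because the exits
of a program are wired directly to the next label. The machine is constrained only at the labels of
`p`, so that the induction can descend to subprograms of a larger machine. The initial internal
state `v` is arbitrary, since it is read only right after a pop has overwritten it. -/
theorem Exec.reachesIn [DecidableEq K] {Λ : Type} {M : Λ → TM2.Stmt (Prog.Entry K A) Λ (Option A)}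
    {p : Prog K A} {S S' : Store K A} {t : ℕ} {r : Outcome} (h : Exec p S t r S') :
    ∀ (emb : p.Label → Λ) (ex : Outcome → Λ), (∀ l, M (emb l) = p.code emb ex l) →
      ∀ v, ∃ v', ReachesIn (TM2.step M) t ⟨some (emb p.start), v, stackContents S []⟩
        ⟨some (ex r), v', stackContents S' []⟩ := by
  induction h with
  | push k a S =>
    intro emb ex hM v
    refine ⟨v, .single ?_⟩
    simp only [TM2.step, hM, Prog.code, TM2.stepAux]
    rw [stackContents_update]
    rfl
  | @pop k f S S' t r h ih =>
    intro emb ex hM v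
    obtain ⟨v', h'⟩ := ih (fun l => emb (some ⟨_, l⟩)) ex (fun l => hM (some ⟨_, l⟩))
      (S k).head?
    refine ⟨v', ?_⟩
    rw [add_comm]
    refine ReachesIn.trans (.single ?_) h'
    refine (congrArg (fun s => some (TM2.stepAux s v (stackContents S []))) (hM none)).trans ?_
    have := stackContents_update S [] k (S k).tail
    simp only [Prog.code, TM2.stepAux, ← this]
    rfl
  | @seq_next p q S S₁ S' t t' r h₁ h₂ ih₁ ih₂ =>
    intro emb ex hM v
    obtain ⟨v₁, h₁⟩ := ih₁ (fun l => emb (Sum.inl l)) _ (fun l => hM (Sum.inl l)) v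
    obtain ⟨v₂, h₂⟩ := ih₂ (fun l => emb (Sum.inr l)) ex (fun l => hM (Sum.inr l)) v₁
    exact ⟨v₂, h₁.trans h₂⟩
  | seq_brk _ ih => exact fun emb ex hM v => ih _ _ (fun l => hM (Sum.inl l)) v
  | seq_rej _ ih => exact fun emb ex hM v => ih _ _ (fun l => hM (Sum.inl l)) v
  | @loop_next p S S₁ S' t t' r h₁ h₂ ih₁ ih₂ =>
    intro emb ex hM v
    obtain ⟨v₁, h₁⟩ := ih₁ emb _ hM v
    obtain ⟨v₂, h₂⟩ := ih₂ emb ex hM v₁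
    exact ⟨v₂, h₁.trans h₂⟩
  | loop_brk _ ih => exact fun emb ex hM v => ih emb _ hM v
  | loop_rej _ ih => exact fun emb ex hM v => ih emb _ hM v
  | exit r S =>
    intro emb ex hM v
    refine ⟨v, .single ?_⟩
    simp only [TM2.step, hM, Prog.code, TM2.stepAux]

end Compiler

/-! ### Loops over a stack, and emptying stacks. -/

section Routines

variable {K A : Type} [DecidableEq K]

/-- Pop all entries of the stack `k`, and execute `body` on each of them. -/
def each (k : K) (body : A → Prog K A) : Prog K A :=
  .loop (.pop k fun o => match o with
    | none => .exit .brk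
    | some a => body a)

/-- Empty the stack `k`. -/
def clear (k : K) : Prog K A := each k fun _ => .exit .next

/-- The two steps are the pop that finds nothing, which leaves the store unchanged, and the exit
from the loop. -/
theorem wp_each_nil {k : K} {body : A → Prog K A} {S : Store K A} (h : S k = [])
    {Q : ℕ → Outcome → Store K A → Prop} (hQ : Q 2 .next S) : wp (each k body) S Q := by
  rw [each, wp_loop, wp_pop, h]
  simp only [List.head?_nil, wp_exit, List.tail_nil]
  rwa [← h, update_eq_self]

theorem wp_each_cons {k : K} {body : A → Prog K A} {S : Store K A} {a : A} {l : List A}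
    (h : S k = a :: l) {Q : ℕ → Outcome → Store K A → Prop}
    (hQ : wp (body a) (update S k l) fun t => loopPost (.pop k fun o => match o with
      | none => .exit .brk
      | some a => body a) Q (t + 1)) : wp (each k body) S Q := by
  rw [each, wp_loop, wp_pop, h]
  exact hQ

theorem wp_clear {k : K} {S : Store K A} {Q : ℕ → Outcome → Store K A → Prop}
    (hQ : Q (2 * (S k).length + 2) .next (update S k [])) : wp (clear k) S Q := by
  induction h : S k generalizing S Q with
  | nil =>
    rw [← h, update_eq_self, h] at hQ
    exact wp_each_nil h hQ
  | cons a l ih =>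
    refine wp_each_cons h (wp_exit.2 ?_)
    refine ih ?_ (by simp)
    rw [h] at hQ
    simp only [update_self, update_idem, List.length_cons] at hQ ⊢
    convert hQ using 1
    omega

/-- Empty the given stacks. -/
def clearAll : List K → Prog K A
  | [] => .exit .next
  | k :: l => clear k ;; clearAll l

/-- Every entry is removed at most once at a cost of two steps. Each listed stack adds two steps for
noticing that it is empty, and the final exit adds one. -/
theorem wp_clearAll [Fintype K] (l : List K) (S : Store K A) :
    wp (clearAll l) S fun t r S' =>
      t ≤ 2 * ∑ i, (S i).length + 2 * l.length + 1 ∧ r = .next ∧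
        ∀ k, S' k = if k ∈ l then [] else S k := by
  induction l generalizing S with
  | nil => exact wp_exit.2 (by simp)
  | cons k l ih =>
    refine wp_seq.2 (wp_clear ((ih _).mono ?_))
    rintro t r S' ⟨ht, rfl, hS'⟩
    have := sum_length_update S k []
    simp only [List.length_nil] at this
    refine ⟨by simp only [List.length_cons]; omega, rfl, fun i => ?_⟩
    rw [hS', update_apply]
    split_ifs <;> simp_all

end Routines

/-! ### From a polynomial-time program to membership in P. -/

section Machine

variable {K A : Type}

/-- The labels of the machine that executes `p`, then `q`, and outputs whether `p` rejected. -/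
inductive DeciderLabel (p q : Prog K A) : Type
  | run (l : p.Label)
  | clean (b : Bool) (l : q.Label)
  | answer (b : Bool)

theorem DeciderLabel.finite [Finite A] (p q : Prog K A) : Finite (DeciderLabel p q) := by
  have := p.finite_label
  have := q.finite_label
  refine Finite.of_injective (β := p.Label ⊕ (Bool × q.Label) ⊕ Bool)
    (fun
      | run l => .inl l
      | clean b l => .inr (.inl (b, l))
      | answer b => .inr (.inr b)) ?_
  rintro (_ | _ | _) (_ | _ | _) h <;> simp_all

/-- Where the machine continues after the program: it empties the stacks, remembering the
answer. -/
def deciderExit (p q : Prog K A) : Outcome → DeciderLabel p q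
  | .next => .clean true q.start
  | .brk => .clean false q.start
  | .rej => .clean false q.start

variable [DecidableEq K] [Fintype K] [Fintype A]

/-- The program that empties all stacks. -/
noncomputable def cleanup (K A : Type) [Fintype K] : Prog K A := clearAll Finset.univ.toList

/-- The machine that accepts if the program `p` ends normally, with input on the stack `k₀`. -/
noncomputable def decider (p : Prog K A) (k₀ : K) : FinTM2 where
  K := Option K
  k₀ := some k₀
  k₁ := none
  Γ := Prog.Entry K A
  Λ := DeciderLabel p (cleanup K A)
  main := .run p.start
  ΛFin := @Fintype.ofFinite _ (DeciderLabel.finite _ _)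
  σ := Option A
  initialState := none
  Γk₀Fin := inferInstanceAs (Fintype A)
  m
    | .run l => p.code .run (deciderExit _ _) l
    | .clean b l => (cleanup K A).code (.clean b) (fun _ => .answer b) l
    -- A halting configuration must have the initial internal state and nothing but the output on
    -- its stacks. This is why the state is reset here and why `cleanup` runs before.
    | .answer b => .push none (fun _ => b) (.load (fun _ => none) .halt)

/-- The store with the word `w` on the stack `k` and nothing on the other stacks. -/
def initStore (k : K) (w : List A) : Store K A := update (fun _ => []) k w

theorem initList_decider (p : Prog K A) (k₀ : K) (w : List A) :
    initList (decider p k₀) w =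
      ⟨some (.run p.start), none, stackContents (initStore k₀ w) []⟩ := by
  refine congrArg (TM2.Cfg.mk (some (DeciderLabel.run p.start)) none) ?_
  funext k
  cases k with
  | none => rfl
  | some k =>
    by_cases hk : k = k₀
    · subst hk
      exact (dif_pos rfl).trans (update_self k w (fun _ => [])).symm
    · exact (dif_neg (by simpa [decider] using hk)).trans (update_of_ne hk w (fun _ => [])).symm

theorem haltList_decider (p : Prog K A) (k₀ : K) (l : List Bool) :
    haltList (decider p k₀) l = ⟨none, none, stackContents (fun _ => []) l⟩ := by
  refine congrArg (TM2.Cfg.mk none none) ?_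
  funext k
  cases k <;> rfl

/-- A program that ends normally on the words of `L` and not on the others, in polynomial time,
yields a Turing machine for `L`. -/
theorem inP_of_prog (p : Prog K A) (k₀ : K) (L : Language A)
    (B : Polynomial ℕ)
    (hp : ∀ w, wp p (initStore k₀ w) fun t r _ =>
      t ≤ B.eval w.length ∧ (r = .next ↔ w ∈ L)) : MDL.InP L := by
  classical
  -- The program takes at most `B` steps and leaves at most `B` entries more than the input.
  -- Emptying the stacks costs two steps per entry, two per stack and one more, and writing the
  -- answer costs one.
  refine ⟨⟨⟨decider p k₀, Equiv.refl A, Equiv.refl Bool⟩,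
    3 * B + 2 * Polynomial.X + Polynomial.C (2 * Fintype.card K + 2), fun w => ?_⟩⟩
  -- The goal is data, namely a bounded computation; passing to its nonemptiness allows the
  -- existential statements below to be opened.
  refine @Classical.choice _ ?_
  obtain ⟨t, r, S, h, ht, hr⟩ := hp w
  obtain ⟨v, h₁⟩ := h.reachesIn (M := (decider p k₀).m) .run (deciderExit _ _) (fun _ => rfl) none
  obtain ⟨t', r', S', h', ht', rfl, hS'⟩ := wp_clearAll (Finset.univ.toList : List K) S
  obtain ⟨v', h₂⟩ := h'.reachesIn (M := (decider p k₀).m) (.clean (decide (w ∈ L)))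
    (fun _ => .answer (decide (w ∈ L))) (fun _ => rfl) v
  have hex : deciderExit p (cleanup K A) r =
      .clean (decide (w ∈ L)) (cleanup K A).start := by
    by_cases hw : w ∈ L
    · rw [hr.2 hw]
      simp [deciderExit, hw]
    · have : r ≠ .next := fun h => hw (hr.1 h)
      cases r <;> simp_all [deciderExit]
  have hS'' : S' = fun _ => [] := by
    funext k
    simp [hS']
  rw [hex] at h₁
  subst hS''
  have h₃ : ReachesIn (decider p k₀).step 1
      ⟨some (.answer (decide (w ∈ L))), v', stackContents (fun _ => []) []⟩
      ⟨none, none, stackContents (fun _ => []) [decide (w ∈ L)]⟩ := by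
    refine .single ?_
    simp only [FinTM2.step, decider, TM2.step, TM2.stepAux]
    exact congrArg (fun T => some (TM2.Cfg.mk none none T))
      (update_out_stackContents (fun _ => []) [] [decide (w ∈ L)])
  have hsum := h.sum_length_le
  have hinit := sum_length_update (fun _ : K => ([] : List A)) k₀ w
  simp only [List.length_nil, Finset.sum_const_zero, add_zero, zero_add] at hinit
  rw [initStore, hinit] at hsum
  refine ⟨⟨⟨t + t' + 1, ?_⟩, ?_⟩⟩
  · have h₄ := (h₁.trans h₂).trans h₃
    have e₁ : w.map (Equiv.refl A).symm = w := List.map_id w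
    refine Eq.trans ?_ (Eq.trans h₄ (congrArg some (haltList_decider p k₀ [decide (w ∈ L)]).symm))
    exact congrArg (fun c => (flip bind (decider p k₀).step)^[t + t' + 1] (some c))
      ((congrArg (initList (decider p k₀)) e₁).trans (initList_decider p k₀ w))
  · simp only [Polynomial.eval_add, Polynomial.eval_mul, Polynomial.eval_X, Polynomial.eval_C,
      Polynomial.eval_ofNat, id]
    simp only [Finset.length_toList, Finset.card_univ] at ht'
    omega

end Machine

/-! ### Programs with a fixed result, and moving or copying stacks. -/

section Ends

variable {K A : Type} [DecidableEq K]

/-- Started on `S`, the program `p` ends normally with the store `S'` after at most `B` steps. -/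
def Ends (p : Prog K A) (S : Store K A) (B : ℕ) (S' : Store K A) : Prop :=
  wp p S fun t r S'' => t ≤ B ∧ r = .next ∧ S'' = S'

/-- Started on `S`, the program `p` rejects after at most `B` steps. -/
def Rejects (p : Prog K A) (S : Store K A) (B : ℕ) : Prop :=
  wp p S fun t r _ => t ≤ B ∧ r = .rej

variable {p q : Prog K A} {S S₁ S₂ : Store K A} {B B' C : ℕ}
  {Q : ℕ → Outcome → Store K A → Prop}

theorem Ends.congr (h : Ends p S B S₁) (hB : B ≤ C) (hS : S₁ = S₂) : Ends p S C S₂ :=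
  wp.mono h fun _ _ _ h => ⟨h.1.trans hB, h.2.1, h.2.2.trans hS⟩

theorem Rejects.mono (h : Rejects p S B) (hB : B ≤ C) : Rejects p S C :=
  wp.mono h fun _ _ _ h => ⟨h.1.trans hB, h.2⟩

/-- Serves when the continuation `q` may either succeed or reject. Only a bound on the time of `p`
is recorded, hence the quantification over `t`. -/
theorem Ends.wp_seq (h : Ends p S B S₁) (hq : ∀ t ≤ B, wp q S₁ fun t' => Q (t + t')) :
    wp (p ;; q) S Q := by
  refine StackProgram.wp_seq.2 (wp.mono h ?_)
  rintro t r S' ⟨ht, rfl, rfl⟩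
  exact hq t ht

theorem Ends.seq (h : Ends p S B S₁) (h' : Ends q S₁ B' S₂) : Ends (p ;; q) S (B + B') S₂ :=
  h.wp_seq fun _ ht => wp.mono h' fun _ _ _ h => ⟨Nat.add_le_add ht h.1, h.2⟩

theorem Ends.seq_rejects (h : Ends p S B S₁) (h' : Rejects q S₁ B') :
    Rejects (p ;; q) S (B + B') :=
  h.wp_seq fun _ ht => wp.mono h' fun _ _ _ h => ⟨Nat.add_le_add ht h.1, h.2⟩

theorem Rejects.seq (h : Rejects p S B) : Rejects (p ;; q) S B := by
  refine StackProgram.wp_seq.2 (wp.mono h ?_)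
  rintro t r S' ⟨ht, rfl⟩
  exact ⟨ht, rfl⟩

theorem ends_push (k : K) (a : A) : Ends (.push k a) S 1 (update S k (a :: S k)) :=
  wp_push.2 ⟨le_rfl, rfl, rfl⟩

theorem ends_exit : Ends (.exit .next : Prog K A) S 1 S := wp_exit.2 ⟨le_rfl, rfl, rfl⟩

theorem rejects_exit : Rejects (.exit .rej : Prog K A) S 1 := wp_exit.2 ⟨le_rfl, rfl⟩

theorem ends_pop {k : K} {f : Option A → Prog K A} {o : Option A} {l : List A}
    (ho : (S k).head? = o) (hl : (S k).tail = l)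
    (h : Ends (f o) (update S k l) B S₁) : Ends (.pop k f) S (B + 1) S₁ := by
  subst ho hl
  exact wp_pop.2 (wp.mono h fun _ _ _ h => ⟨Nat.add_le_add_right h.1 1, h.2⟩)

theorem rejects_pop {k : K} {f : Option A → Prog K A} {o : Option A} {l : List A}
    (ho : (S k).head? = o) (hl : (S k).tail = l)
    (h : Rejects (f o) (update S k l) B) : Rejects (.pop k f) S (B + 1) := by
  subst ho hl
  exact wp_pop.2 (wp.mono h fun _ _ _ h => ⟨Nat.add_le_add_right h.1 1, h.2⟩)

theorem Ends.loop (h : Ends p S B S₁) (h' : Ends (.loop p) S₁ B' S₂) :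
    Ends (.loop p) S (B + B') S₂ := by
  refine wp_loop.2 (wp.mono h ?_)
  rintro t r S' ⟨ht, rfl, rfl⟩
  exact wp.mono h' fun _ _ _ h => ⟨Nat.add_le_add ht h.1, h.2⟩

variable {k : K} {body : A → Prog K A} {a : A} {l : List A}

theorem ends_each_nil (h : S k = []) : Ends (each k body) S 2 S :=
  wp_each_nil h ⟨le_rfl, rfl, rfl⟩

theorem Ends.wp_each (hk : S k = a :: l) (h : Ends (body a) (update S k l) B S₁)
    (h' : ∀ t ≤ B, wp (each k body) S₁ fun t' => Q (t + 1 + t')) : wp (each k body) S Q := by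
  refine wp_each_cons hk (wp.mono h ?_)
  rintro t r S' ⟨ht, rfl, rfl⟩
  exact h' t ht

theorem Ends.each (hk : S k = a :: l) (h : Ends (body a) (update S k l) B S₁)
    (h' : Ends (each k body) S₁ B' S₂) : Ends (each k body) S (B + 1 + B') S₂ :=
  h.wp_each hk fun _ ht => wp.mono h' fun _ _ _ h =>
    ⟨Nat.add_le_add (Nat.add_le_add_right ht 1) h.1, h.2⟩

theorem Ends.each_rejects (hk : S k = a :: l) (h : Ends (body a) (update S k l) B S₁)
    (h' : Rejects (StackProgram.each k body) S₁ B') :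
    Rejects (StackProgram.each k body) S (B + 1 + B') :=
  h.wp_each hk fun _ ht => wp.mono h' fun _ _ _ h =>
    ⟨Nat.add_le_add (Nat.add_le_add_right ht 1) h.1, h.2⟩

theorem Rejects.each (hk : S k = a :: l) (h : Rejects (body a) (update S k l) B) :
    Rejects (each k body) S (B + 1) := by
  refine wp_each_cons hk (wp.mono h ?_)
  rintro t r S' ⟨ht, rfl⟩
  exact ⟨Nat.add_le_add_right ht 1, rfl⟩

theorem ends_clear (k : K) : Ends (clear k) S (2 * (S k).length + 2) (update S k []) :=
  wp_clear ⟨le_rfl, rfl, rfl⟩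

/-- Move all entries of the stack `k` to the stack `k'`, transforming them by `f`. -/
def moveMap (f : A → A) (k k' : K) : Prog K A := StackProgram.each k fun a => .push k' (f a)

/-- Move all entries of the stack `k` to the stack `k'`, which reverses their order. -/
def move (k k' : K) : Prog K A := moveMap id k k'

/-- Move all entries of the stack `k` to the stack `k'`, and the entries transformed by `f` to the
stack `k''`. -/
def dupMap (f : A → A) (k k' k'' : K) : Prog K A :=
  StackProgram.each k fun a => .push k' a ;; .push k'' (f a)

theorem ends_moveMap (f : A → A) {k k' : K} (h : k ≠ k') (S : Store K A) :
    Ends (moveMap f k k') S (2 * (S k).length + 2)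
      (update (update S k []) k' (((S k).map f).reverse ++ S k')) := by
  induction hl : S k generalizing S with
  | nil =>
    refine (ends_each_nil hl).congr (by simp) ?_
    funext i
    by_cases h₁ : i = k <;> by_cases h₂ : i = k' <;> simp_all
  | cons a l ih =>
    refine ((ends_push k' (f a)).each hl (ih _ (by simp [h]))).congr
      (by simp only [List.length_cons]; omega) ?_
    funext i
    by_cases h₁ : i = k <;> by_cases h₂ : i = k' <;> simp_all [update_apply]

theorem ends_move {k k' : K} (h : k ≠ k') (S : Store K A) :
    Ends (move k k') S (2 * (S k).length + 2)
      (update (update S k []) k' ((S k).reverse ++ S k')) := by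
  have := ends_moveMap id h S
  rwa [List.map_id] at this

theorem ends_dupMap (f : A → A) {k k' k'' : K} (h : k ≠ k') (h' : k ≠ k'') (h'' : k' ≠ k'')
    (S : Store K A) :
    Ends (dupMap f k k' k'') S (3 * (S k).length + 2)
      (update (update (update S k []) k' ((S k).reverse ++ S k')) k''
        (((S k).map f).reverse ++ S k'')) := by
  induction hl : S k generalizing S with
  | nil =>
    refine (ends_each_nil hl).congr (by simp) ?_
    funext i
    by_cases h₁ : i = k <;> by_cases h₂ : i = k' <;> by_cases h₃ : i = k'' <;>
      simp_all [update_apply]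
  | cons a l ih =>
    refine (((ends_push k' a).seq (ends_push k'' (f a))).each hl
      (ih _ (by simp [h, h']))).congr (by simp only [List.length_cons]; omega) ?_
    funext i
    by_cases h₁ : i = k <;> by_cases h₂ : i = k' <;> by_cases h₃ : i = k'' <;>
      simp_all [update_apply]

/-- Put the entries of the stack `k`, transformed by `f`, on the stack `k'` in reverse order,
with the help of the empty stack `h`. -/
def copyMap (f : A → A) (k h k' : K) : Prog K A := dupMap f k h k' ;; move h k

/-- The entries travel to `h` and back, which reverses them twice and restores `k`, whereas the copy
on `k'` is reversed once. -/
theorem ends_copyMap (f : A → A) {k h k' : K} (h₁ : k ≠ h) (h₂ : k ≠ k') (h₃ : h ≠ k')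
    (S : Store K A) (hS : S h = []) :
    Ends (copyMap f k h k') S (5 * (S k).length + 4)
      (update S k' (((S k).map f).reverse ++ S k')) := by
  refine ((ends_dupMap f h₁ h₂ h₃ S).seq (ends_move h₁.symm _)).congr ?_ ?_
  · simp [h₃, hS]
    omega
  · funext i
    by_cases e₁ : i = k <;> by_cases e₂ : i = h <;> by_cases e₃ : i = k' <;>
      simp_all [update_apply]

end Ends

end StackProgram

/-! ### Stacks of the model checker; matrices of pairs and their filtering. -/

namespace MDL

open StackProgram

/-- The stacks of the model checking program. -/
inductive Var
  /-- the unread part of the input -/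
  | inp
  /-- the teams in which the remaining formulas have to be evaluated -/
  | teams
  /-- the current team -/
  | team
  | team2
  /-- the matrix of the accessibility relation, each row followed by a separator -/
  | rel
  /-- the matrix of the labeling function, each row followed by a separator -/
  | lab
  | buf
  | vec
  | vec2
  /-- a row of zeros, with one entry for each proposition -/
  | zer
  | out
  | colA
  | colB
  | colC
  /-- a square matrix -/
  | sq
  /-- the pairs of worlds that have to agree -/
  | pairs
  | pairs2
  deriving DecidableEq

instance : Fintype Var where
  elems := {.inp, .teams, .team, .team2, .rel, .lab, .buf, .vec, .vec2, .zer, .out, .colA, .colB,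
    .colC, .sq, .pairs, .pairs2}
  complete x := by cases x <;> decide

abbrev Program := Prog Var Sym
abbrev Stacks := Store Var Sym

/-- Given a column on the stack `out`, compute the matrix of the values of `op` for all pairs of
entries. -/
def square (op : Sym → Sym → Sym) : Program :=
  dupMap id .out .colA .colB ;;
  each .colA (fun a => dupMap (op a) .colB .colC .sq ;; move .colC .colB) ;;
  clear .colB

/-- Every iteration sends `colB` to `colC` and back, so the next one finds it intact. Per entry of
`colA` this costs one pop, `3 * d.length + 2` for the duplication and `2 * d.length + 2` for the way
back. -/
theorem ends_square_loop (op : Sym → Sym → Sym) (d l : List Sym) (S : Stacks)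
    (hA : S .colA = l) (hB : S .colB = d) (hC : S .colC = []) :
    Ends (each .colA fun a => dupMap (op a) .colB .colC .sq ;; move .colC .colB) S
      (l.length * (5 * d.length + 5) + 2)
      (update (update S .colA []) .sq ((l.flatMap fun a => d.map (op a)).reverse ++ S .sq)) := by
  induction l generalizing S with
  | nil =>
    refine (ends_each_nil hA).congr (by simp) ?_
    funext k
    cases k <;> simp [hA]
  | cons a l ih =>
    refine (((ends_dupMap (op a) (by simp) (by simp) (by simp) _).seq
      (ends_move (by simp) _)).each hA (ih _ ?_ ?_ ?_)).congr ?_ ?_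
    · simp
    · simp [hB, hC]
    · simp
    · simp [hB, hC]
      grind
    · funext k
      cases k <;> simp [hB, hC]

/-- The matrix stands on `sq` in reverse order; the enumeration `allPairs` of pairs is reversed to
match. -/
theorem ends_square (op : Sym → Sym → Sym) (c : List Sym) (S : Stacks)
    (hO : S .out = c.reverse) (hA : S .colA = []) (hB : S .colB = []) (hC : S .colC = [])
    (hX : S .sq = []) :
    Ends (square op) S (10 * (c.length + 1) ^ 2)
      (update (update S .out []) .sq (c.flatMap fun a => c.map (op a)).reverse) := by
  refine ((ends_dupMap id (by simp) (by simp) (by simp) _).seq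
    ((ends_square_loop op c c _ ?_ ?_ ?_).seq (ends_clear _))).congr ?_ ?_
  · simp [hO, hA]
  · simp [hO, hB]
  · simp [hC]
  · simp [hO, hB]
    grind
  · funext k
    cases k <;> simp [hA, hB, hX]

/-- Replace the entries `e` of the stack `pairs` by `f e x`, where the `x` are the corresponding
entries of the stack `sq`. Reject if there is no value. -/
def refinePairs (f : Sym → Sym → Option Sym) : Program :=
  each .sq (fun x => .pop .pairs fun
    | none => .exit .rej
    | some e => match f e x with
      | none => .exit .rej
      | some y => .push .pairs2 y) ;;
  move .pairs2 .pairs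

section Refine

variable {ι : Type*} {f : Sym → Sym → Option Sym} {e x : ι → Sym} {l : List ι} {S : Stacks}

/-- Writing both stacks as images of one list `l` expresses that they are aligned entry by entry. -/
theorem ends_refinePairs_loop {y : ι → Sym} (hX : S .sq = l.map x) (hE : S .pairs = l.map e)
    (hf : ∀ i ∈ l, f (e i) (x i) = some (y i)) :
    Ends (each .sq fun x => .pop .pairs fun
    | none => .exit .rej
    | some e => match f e x with
      | none => .exit .rej
      | some y => .push .pairs2 y) S (3 * l.length + 2)
      (update (update (update S .sq []) .pairs []) .pairs2
        ((l.map y).reverse ++ S .pairs2)) := by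
  induction l generalizing S with
  | nil =>
    refine (ends_each_nil hX).congr (by simp) ?_
    funext k
    cases k <;> simp_all
  | cons i l ih =>
    refine ((ends_pop (B := 1) (o := some (e i)) (l := l.map e)
      (S₁ := update (update (update S .sq (l.map x)) .pairs (l.map e)) .pairs2
        (y i :: S .pairs2)) (by simp [hE]) (by simp [hE]) ?_).each hX
      (ih ?_ ?_ fun i hi => hf i (List.mem_cons_of_mem _ hi))).congr ?_ ?_
    · simp only [hf i List.mem_cons_self]
      refine (ends_push _ _).congr le_rfl ?_
      simp
    · simp
    · simp
    · simp only [List.length_cons]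
      omega
    · funext k
      cases k <;> simp

theorem ends_refinePairs {y : ι → Sym} (hX : S .sq = l.map x) (hE : S .pairs = l.map e)
    (h2 : S .pairs2 = []) (hf : ∀ i ∈ l, f (e i) (x i) = some (y i)) :
    Ends (refinePairs f) S (5 * l.length + 4) (update (update S .sq []) .pairs (l.map y)) := by
  refine ((ends_refinePairs_loop hX hE hf).seq (ends_move (by simp) _)).congr ?_ ?_
  · simp [h2]
    omega
  · funext k
    cases k <;> simp [h2]

theorem rejects_refinePairs (hX : S .sq = l.map x) (hE : S .pairs = l.map e)
    (hf : ∃ i ∈ l, f (e i) (x i) = none) : Rejects (refinePairs f) S (5 * l.length + 4) := by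
  refine (Rejects.seq (B := 3 * l.length) ?_).mono (by omega)
  induction l generalizing S with
  | nil => simp at hf
  | cons i l ih =>
    cases h : f (e i) (x i) with
    | none =>
      refine (Rejects.each hX (rejects_pop (o := some (e i)) (l := l.map e)
        (by simp [hE]) (by simp [hE]) (B := 1) ?_)).mono (by simp only [List.length_cons]; omega)
      simp only [h]
      exact rejects_exit
    | some y =>
      refine ((ends_pop (B := 1) (o := some (e i)) (l := l.map e)
        (S₁ := update (update (update S .sq (l.map x)) .pairs (l.map e)) .pairs2
          (y :: S .pairs2)) (by simp [hE]) (by simp [hE]) ?_).each_rejects hX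
        (ih ?_ ?_ ?_)).mono ?_
      · simp only [h]
        refine (ends_push _ _).congr le_rfl ?_
        simp
      · simp
      · simp
      · obtain ⟨j, hj, hf⟩ := hf
        rcases List.mem_cons.1 hj with rfl | hj
        · simp [h] at hf
        · exact ⟨j, hj, hf⟩
      · simp only [List.length_cons]
        omega

end Refine

end MDL

/-! ### One pass over a matrix along the team. -/

namespace MDL

open StackProgram

/-- Whether a symbol is a bit. -/
def Sym.isBit : Sym → Bool
  | .zero => true
  | .one => true
  | _ => false

/-- The action of `sweep` on an entry `a` of the stack `vec`, an entry `t` of the team and an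
entry of the row. -/
def sweepCell (f : Sym → Sym → Sym → Sym) (g : Sym → Bool) (t a : Sym) :
    Option Sym → Program
  | none => .exit .rej
  | some b =>
    if b.isBit then
      .push .buf b ;; .push .vec2 (f t a b) ;; if g a then .push .out b else .exit .next
    else .exit .rej

/-- The action of `sweep` on a row of the matrix `M`. -/
def sweepRow (f : Sym → Sym → Sym → Sym) (g : Sym → Bool) (M : Var) (t : Sym) : Program :=
  each .vec (fun a => .pop M (sweepCell f g t a)) ;;
  .pop M (fun
    | some .sep => .push .buf .sep
    | _ => .exit .rej) ;;
  move .vec2 .vec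

/-- For each entry `t` of the team and the corresponding row of the matrix `M`, replace each entry
`a` of `vec` by `f t a b`, where `b` is the corresponding entry of the row, and put `b` on
`out` if `g a` holds. Reject if the length of a row is not the length of `vec`. -/
def sweep (f : Sym → Sym → Sym → Sym) (g : Sym → Bool) (M : Var) : Program :=
  each .team (fun t => .push .team2 t ;; sweepRow f g M t) ;; move .buf M ;; move .team2 .team

/-- The entries of `row` at the positions at which the entries of `v` satisfy `g`. -/
def selected (g : Sym → Bool) (v row : List Sym) : List Sym :=
  ((v.zip row).filter fun p => g p.1).map Prod.snd

/-- The effect of `sweep` on the stacks `vec` and `out`. -/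
def sweepResult {ι : Type*} (f : Sym → Sym → Sym → Sym) (g : Sym → Bool) (t : ι → Sym)
    (row : ι → List Sym) : List ι → List Sym → List Sym → List Sym × List Sym
  | [], v, o => (v, o)
  | i :: l, v, o =>
    sweepResult f g t row l (v.zipWith (f (t i)) (row i)) ((selected g v (row i)).reverse ++ o)

variable {f : Sym → Sym → Sym → Sym} {g : Sym → Bool} {M : Var}

/-- The hypothesis `hM` keeps `M` apart from the work stacks, so that the updates do not interfere.
-/
theorem ends_sweepCell (hM : M = .rel ∨ M = .lab) {t a b : Sym} {l : List Sym} {S : Stacks}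
    (hS : S M = b :: l) (hb : b.isBit) :
    Ends (.pop M (sweepCell f g t a)) S 4
      (update (update (update (update S M l) .buf (b :: S .buf)) .vec2 (f t a b :: S .vec2))
        .out (if g a then b :: S .out else S .out)) := by
  refine ends_pop (B := 3) (o := some b) (l := l) (by simp [hS]) (by simp [hS]) ?_
  simp only [sweepCell, hb, if_true]
  refine ((ends_push _ _).seq ((ends_push _ _).seq (B' := 1)
    (S₂ := update (update (update (update S M l) .buf (b :: S .buf)) .vec2 (f t a b :: S .vec2))
      .out (if g a then b :: S .out else S .out)) ?_)).congr (by omega) rfl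
  split_ifs
  · refine (ends_push _ _).congr le_rfl ?_
    funext k
    rcases hM with rfl | rfl <;> cases k <;> simp
  · refine ends_exit.congr le_rfl ?_
    funext k
    rcases hM with rfl | rfl <;> cases k <;> simp

theorem ends_sweepCells (hM : M = .rel ∨ M = .lab) {t : Sym} {v row r : List Sym} {S : Stacks}
    (hv : S .vec = v) (hS : S M = row ++ r) (hrow : ∀ b ∈ row, b.isBit)
    (hl : row.length = v.length) :
    Ends (each .vec fun a => .pop M (sweepCell f g t a)) S (5 * v.length + 2)
      (update (update (update (update (update S .vec []) M r) .buf (row.reverse ++ S .buf))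
        .vec2 ((v.zipWith (f t) row).reverse ++ S .vec2))
        .out ((selected g v row).reverse ++ S .out)) := by
  induction v generalizing row S with
  | nil =>
    obtain rfl := List.length_eq_zero_iff.1 hl
    rw [List.nil_append] at hS
    refine (ends_each_nil hv).congr (by simp) ?_
    funext k
    rcases hM with rfl | rfl <;> cases k <;> simp [hv, selected, hS]
  | cons a v ih =>
    obtain ⟨b, row, rfl⟩ := List.exists_cons_of_length_eq_add_one hl
    have hb : b.isBit := hrow b List.mem_cons_self
    refine ((ends_sweepCell hM (l := row ++ r) ?_ hb).each hv
      (ih (row := row) ?_ ?_ ?_ ?_)).congr ?_ ?_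
    · rcases hM with rfl | rfl <;> simp [hS]
    · rcases hM with rfl | rfl <;> simp
    · rcases hM with rfl | rfl <;> simp
    · exact fun b hb => hrow b (List.mem_cons_of_mem _ hb)
    · simpa using hl
    · simp only [List.length_cons]
      omega
    · funext k
      rcases hM with rfl | rfl <;> cases k <;> simp [selected, List.filter_cons] <;>
        split_ifs <;> simp

theorem ends_sweepRow (hM : M = .rel ∨ M = .lab) {t : Sym} {v row r : List Sym} {S : Stacks}
    (hv : S .vec = v) (hS : S M = row ++ Sym.sep :: r) (h2 : S .vec2 = [])
    (hrow : ∀ b ∈ row, b.isBit) (hl : row.length = v.length) :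
    Ends (sweepRow f g M t) S (7 * v.length + 6)
      (update (update (update (update S .vec (v.zipWith (f t) row)) M r)
        .buf (Sym.sep :: (row.reverse ++ S .buf)))
        .out ((selected g v row).reverse ++ S .out)) := by
  refine ((ends_sweepCells hM hv hS hrow hl).seq ((ends_pop (o := some .sep) (l := r)
    ?_ ?_ (ends_push _ _)).seq (ends_move (by simp) _))).congr ?_ ?_
  · rcases hM with rfl | rfl <;> simp
  · rcases hM with rfl | rfl <;> simp
  · rcases hM with rfl | rfl <;> simp [h2, hl] <;> omega
  · funext k
    rcases hM with rfl | rfl <;> cases k <;> simp [h2]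

/-- A row that is too short is noticed at once, when its separator is met in place of a bit. A row
that is too long leaves a bit on top of `M`, which the test for the separator in `sweepRow` catches
afterwards. -/
theorem wp_sweepCells (hM : M = .rel ∨ M = .lab) {t : Sym} {v row r : List Sym} {S : Stacks}
    (hv : S .vec = v) (hS : S M = row ++ Sym.sep :: r) (hrow : ∀ b ∈ row, b.isBit)
    (hl : row.length ≠ v.length) :
    wp (each .vec fun a => .pop M (sweepCell f g t a)) S fun t r S' => t ≤ 5 * v.length + 2 ∧
      (r = .rej ∨ r = .next ∧ ∃ b l, S' M = b :: l ∧ b.isBit) := by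
  induction v generalizing row S with
  | nil =>
    cases row with
    | nil => simp at hl
    | cons b row =>
      exact wp_each_nil hv ⟨by omega, .inr ⟨rfl, b, _, hS, hrow b List.mem_cons_self⟩⟩
  | cons a v ih =>
    cases row with
    | nil =>
      refine wp.mono (Rejects.each (B := 2) hv (rejects_pop (o := some .sep) (l := r) ?_ ?_
        rejects_exit)) ?_
      · rcases hM with rfl | rfl <;> simp [hS]
      · rcases hM with rfl | rfl <;> simp [hS]
      · rintro t r S' ⟨ht, rfl⟩
        exact ⟨by simp only [List.length_cons]; omega, .inl rfl⟩
    | cons b row =>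
      have hb : b.isBit := hrow b List.mem_cons_self
      refine (ends_sweepCell hM (l := row ++ Sym.sep :: r) ?_ hb).wp_each hv
        fun t ht => wp.mono (ih (row := row) ?_ ?_ ?_ ?_) ?_
      · rcases hM with rfl | rfl <;> simp [hS]
      · rcases hM with rfl | rfl <;> simp
      · rcases hM with rfl | rfl <;> simp
      · exact fun b hb => hrow b (List.mem_cons_of_mem _ hb)
      · simpa using hl
      · rintro t' r S' ⟨ht', h⟩
        exact ⟨by simp only [List.length_cons]; omega, h⟩

theorem rejects_sweepRow (hM : M = .rel ∨ M = .lab) {t : Sym} {v row r : List Sym} {S : Stacks}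
    (hv : S .vec = v) (hS : S M = row ++ Sym.sep :: r) (hrow : ∀ b ∈ row, b.isBit)
    (hl : row.length ≠ v.length) :
    Rejects (sweepRow f g M t) S (7 * v.length + 6) := by
  refine wp_seq.2 (wp.mono (wp_sweepCells hM hv hS hrow hl) ?_)
  rintro t r S' ⟨ht, rfl | ⟨rfl, b, l, hb, hbit⟩⟩
  · exact ⟨by omega, rfl⟩
  · refine wp.mono (Rejects.seq (rejects_pop (o := some b) (l := l) (by simp [hb]) (by simp [hb])
      (B := 1) ?_)) fun t' r _ h => ⟨?_, h.2⟩
    · cases b <;> first | exact rejects_exit | exact absurd hbit (by decide)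
    · have := h.1
      omega

section Sweep

variable {ι : Type*} {t : ι → Sym} {row : ι → List Sym}

theorem ends_sweep_loop (hM : M = .rel ∨ M = .lab) {l : List ι} {v : List Sym} {S : Stacks}
    (hT : S .team = l.map t) (hv : S .vec = v)
    (hS : S M = l.flatMap fun i => row i ++ [Sym.sep]) (h2 : S .vec2 = [])
    (hrow : ∀ i ∈ l, ∀ b ∈ row i, b.isBit) (hl : ∀ i ∈ l, (row i).length = v.length) :
    Ends (each .team fun t => .push .team2 t ;; sweepRow f g M t) S
      (l.length * (7 * v.length + 8) + 2)
      (update (update (update (update (update (update S .team [])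
        .team2 ((l.map t).reverse ++ S .team2))
        .vec (sweepResult f g t row l v (S .out)).1) M [])
        .buf ((l.flatMap fun i => row i ++ [Sym.sep]).reverse ++ S .buf))
        .out (sweepResult f g t row l v (S .out)).2) := by
  induction l generalizing v S with
  | nil =>
    refine (ends_each_nil hT).congr (by omega) ?_
    funext k
    rcases hM with rfl | rfl <;> cases k <;> simp_all [sweepResult]
  | cons i l ih =>
    have hi := hl i List.mem_cons_self
    refine (((ends_push _ _).seq (ends_sweepRow hM (v := v) (row := row i)
      (r := l.flatMap fun i => row i ++ [Sym.sep]) ?_ ?_ ?_ (hrow i List.mem_cons_self) hi)).each hT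
      (ih (v := v.zipWith (f (t i)) (row i)) ?_ ?_ ?_ ?_
        (fun j hj => hrow j (List.mem_cons_of_mem _ hj)) ?_)).congr ?_ ?_
    · simp [hv]
    · rcases hM with rfl | rfl <;> simp [hS]
    · simp [h2]
    · rcases hM with rfl | rfl <;> simp
    · rcases hM with rfl | rfl <;> simp
    · rcases hM with rfl | rfl <;> simp
    · rcases hM with rfl | rfl <;> simp [h2]
    · intro j hj
      rw [hl j (List.mem_cons_of_mem _ hj), List.length_zipWith, hi, min_self]
    · simp only [List.length_cons, List.length_zipWith, hi, min_self]
      ring_nf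
      omega
    · funext k
      rcases hM with rfl | rfl <;> cases k <;> simp [sweepResult]

/-- Rows of the right length leave the length of `vec` unchanged, so the first bad row is compared
with the original length. -/
theorem rejects_sweep_loop (hM : M = .rel ∨ M = .lab) {l : List ι} {v : List Sym} {S : Stacks}
    (hT : S .team = l.map t) (hv : S .vec = v)
    (hS : S M = l.flatMap fun i => row i ++ [Sym.sep]) (h2 : S .vec2 = [])
    (hrow : ∀ i ∈ l, ∀ b ∈ row i, b.isBit) (hl : ∃ i ∈ l, (row i).length ≠ v.length) :
    Rejects (each .team fun t => .push .team2 t ;; sweepRow f g M t) S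
      (l.length * (7 * v.length + 8) + 2) := by
  induction l generalizing v S with
  | nil => simp at hl
  | cons i l ih =>
    by_cases hi : (row i).length = v.length
    · refine (((ends_push _ _).seq (ends_sweepRow hM (v := v) (row := row i)
        (r := l.flatMap fun i => row i ++ [Sym.sep]) ?_ ?_ ?_
        (hrow i List.mem_cons_self) hi)).each_rejects hT
        (ih (v := v.zipWith (f (t i)) (row i)) ?_ ?_ ?_ ?_
          (fun j hj => hrow j (List.mem_cons_of_mem _ hj)) ?_)).mono ?_
      · simp [hv]
      · rcases hM with rfl | rfl <;> simp [hS]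
      · simp [h2]
      · rcases hM with rfl | rfl <;> simp
      · rcases hM with rfl | rfl <;> simp
      · rcases hM with rfl | rfl <;> simp
      · rcases hM with rfl | rfl <;> simp [h2]
      · obtain ⟨j, hj, h⟩ := hl
        rcases List.mem_cons.1 hj with rfl | hj
        · exact absurd hi h
        · refine ⟨j, hj, ?_⟩
          rwa [List.length_zipWith, hi, min_self]
      · simp only [List.length_cons, List.length_zipWith, hi, min_self]
        ring_nf
        omega
    · refine (Rejects.each hT ((ends_push _ _).seq_rejects (rejects_sweepRow hM (v := v)
        (row := row i) (r := l.flatMap fun i => row i ++ [Sym.sep]) ?_ ?_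
        (hrow i List.mem_cons_self) hi))).mono ?_
      · simp [hv]
      · rcases hM with rfl | rfl <;> simp [hS]
      · simp only [List.length_cons]
        ring_nf
        omega

/-- Matrix and team are collected in reverse on `buf` and `team2`, and the last two moves restore
them. The one routine serves to check the shape of a matrix, to extract a column and to compute the
successors of a team. -/
theorem ends_sweep (hM : M = .rel ∨ M = .lab) {l : List ι} {v : List Sym} {S : Stacks}
    (hT : S .team = l.map t) (hv : S .vec = v)
    (hS : S M = l.flatMap fun i => row i ++ [Sym.sep]) (h2 : S .vec2 = []) (hT2 : S .team2 = [])
    (hB : S .buf = []) (hrow : ∀ i ∈ l, ∀ b ∈ row i, b.isBit)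
    (hl : ∀ i ∈ l, (row i).length = v.length) :
    Ends (sweep f g M) S (12 * ((l.length + 1) * (v.length + 1)))
      (update (update S .vec (sweepResult f g t row l v (S .out)).1)
        .out (sweepResult f g t row l v (S .out)).2) := by
  have hlen : (l.flatMap fun i => row i ++ [Sym.sep]).length = l.length * (v.length + 1) := by
    rw [List.length_flatMap, List.map_congr_left (g := fun _ => v.length + 1)
      fun i hi => by simp [hl i hi]]
    simp
  refine ((ends_sweep_loop hM hT hv hS h2 hrow hl).seq ((ends_move (k := .buf) (k' := M) ?_ _).seq
    (ends_move (k := .team2) (k' := .team) (by simp) _))).congr ?_ ?_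
  · rcases hM with rfl | rfl <;> simp
  · have e : ((l.flatMap fun i => row i ++ [Sym.sep]).reverse ++ S .buf).length =
        l.length * (v.length + 1) := by rw [hB, List.append_nil, List.length_reverse, hlen]
    have e' : ((l.map t).reverse ++ S .team2).length = l.length := by simp [hT2]
    rcases hM with rfl | rfl <;>
    · simp only [update_self, ne_eq, reduceCtorEq, not_false_eq_true, update_of_ne, e, e']
      ring_nf
      omega
  · funext k
    rcases hM with rfl | rfl <;> cases k <;> simp [hT2, hB, hT, hS]

theorem rejects_sweep (hM : M = .rel ∨ M = .lab) {l : List ι} {v : List Sym} {S : Stacks}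
    (hT : S .team = l.map t) (hv : S .vec = v)
    (hS : S M = l.flatMap fun i => row i ++ [Sym.sep]) (h2 : S .vec2 = [])
    (hrow : ∀ i ∈ l, ∀ b ∈ row i, b.isBit) (hl : ∃ i ∈ l, (row i).length ≠ v.length) :
    Rejects (sweep f g M) S (12 * ((l.length + 1) * (v.length + 1))) := by
  refine (Rejects.seq (rejects_sweep_loop hM hT hv hS h2 hrow hl)).mono ?_
  ring_nf
  omega

end Sweep

end MDL

/-! ### Unique decoding and reading of the worlds. -/

namespace MDL

open StackProgram

theorem bit_eq_one_iff {P : Prop} : bit P = Sym.one ↔ P := by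
  unfold bit
  split_ifs <;> simp_all

theorem isBit_bit (P : Prop) : (bit P).isBit := by
  unfold bit
  split_ifs <;> rfl

theorem bit_eq_one_of_isBit {a : Sym} (h : a.isBit) : bit (a = .one) = a := by
  cases a <;> simp_all [Sym.isBit, bit]

/-- The data of a world in an instance: membership in the team, the row of the accessibility
relation and the row of the labeling function. -/
abbrev WorldData := Sym × List Sym × List Sym

/-- The word for the data of a world. -/
def worldWord (x : WorldData) : List Sym := x.1 :: (x.2.1 ++ Sym.sep :: (x.2.2 ++ [Sym.sep]))

/-- The data of a world consist of bits. -/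
def WorldData.IsBits (x : WorldData) : Prop :=
  x.1.isBit ∧ (∀ b ∈ x.2.1, b.isBit) ∧ ∀ b ∈ x.2.2, b.isBit

/-- No bit is a separator, so the first separator of the word marks the end of the row. Unary
indices of propositions are decoded by the same lemma. -/
theorem row_append_inj {r r' u u' : List Sym} (hr : ∀ b ∈ r, b.isBit) (hr' : ∀ b ∈ r', b.isBit)
    (h : r ++ Sym.sep :: u = r' ++ Sym.sep :: u') : r = r' ∧ u = u' := by
  induction r generalizing r' with
  | nil =>
    cases r' with
    | nil => simpa using h
    | cons b r' =>
      have := hr' b List.mem_cons_self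
      simp only [List.nil_append, List.cons_append, List.cons.injEq] at h
      rw [← h.1] at this
      exact absurd this (by decide)
  | cons a r ih =>
    cases r' with
    | nil =>
      have := hr a List.mem_cons_self
      simp only [List.nil_append, List.cons_append, List.cons.injEq] at h
      rw [h.1] at this
      exact absurd this (by decide)
    | cons b r' =>
      simp only [List.cons_append, List.cons.injEq] at h
      obtain ⟨rfl, rfl⟩ := ih (fun b hb => hr b (List.mem_cons_of_mem _ hb))
        (fun b hb => hr' b (List.mem_cons_of_mem _ hb)) h.2
      exact ⟨by rw [h.1], rfl⟩

/-- The word does not start with a bit. -/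
def EndsWorlds (u : List Sym) : Prop := ∀ b ∈ u.head?, b.isBit = false

/-- A further world begins with a bit and the remainder does not, so one symbol tells whether the
list of worlds is over. Inside a world the two separators delimit the rows. -/
theorem worldWords_append_inj {l l' : List WorldData} {u u' : List Sym}
    (hl : ∀ x ∈ l, x.IsBits) (hl' : ∀ x ∈ l', x.IsBits) (hu : EndsWorlds u) (hu' : EndsWorlds u')
    (h : l.flatMap worldWord ++ u = l'.flatMap worldWord ++ u') : l = l' ∧ u = u' := by
  induction l generalizing l' with
  | nil =>
    cases l' with
    | nil => simpa using h
    | cons y l' =>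
      have := (hl' y List.mem_cons_self).1
      simp only [List.flatMap_nil, List.nil_append, List.flatMap_cons, worldWord] at h
      subst h
      simp [hu y.1 (by simp)] at this
  | cons x l ih =>
    cases l' with
    | nil =>
      have := (hl x List.mem_cons_self).1
      simp only [List.flatMap_nil, List.nil_append, List.flatMap_cons, worldWord] at h
      subst h
      simp [hu' x.1 (by simp)] at this
    | cons y l' =>
      obtain ⟨hx₁, hx₂, hx₃⟩ := hl x List.mem_cons_self
      obtain ⟨hy₁, hy₂, hy₃⟩ := hl' y List.mem_cons_self
      simp only [List.flatMap_cons, worldWord, List.cons_append, List.append_assoc,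
        List.cons.injEq, List.nil_append] at h
      obtain ⟨h₁, h₂⟩ := row_append_inj hx₂ hy₂ h.2
      obtain ⟨h₃, h₄⟩ := row_append_inj hx₃ hy₃ h₂
      obtain ⟨rfl, rfl⟩ := ih (fun z hz => hl z (List.mem_cons_of_mem _ hz))
        (fun z hz => hl' z (List.mem_cons_of_mem _ hz)) h₄
      refine ⟨?_, rfl⟩
      rw [List.cons.injEq]
      exact ⟨Prod.ext h.1 (Prod.ext h₁ h₃), rfl⟩

/-- Read a row of bits and the following separator from the input. -/
def readRow (k : Var) : Program :=
  .loop (.pop .inp fun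
    | some .zero => .push k .zero
    | some .one => .push k .one
    | some .sep => .push k .sep ;; .exit .brk
    | _ => .exit .rej)

/-- Time is bounded in amortized form, at most three steps per consumed symbol, so that the costs of
successive reads telescope. A rejection has to certify that no decomposition exists. -/
theorem wp_readRow {k : Var} (hk : k ≠ .inp) (S : Stacks) :
    wp (readRow k) S fun t r S' =>
      (r = .next ∧ ∃ row u, (∀ b ∈ row, b.isBit) ∧ S .inp = row ++ Sym.sep :: u ∧
        S' = update (update S .inp u) k (Sym.sep :: (row.reverse ++ S k)) ∧
        t + 3 * u.length ≤ 3 * (S .inp).length) ∨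
      (r = .rej ∧ t ≤ 3 * (S .inp).length + 2 ∧
        ∀ row u, (∀ b ∈ row, b.isBit) → S .inp ≠ row ++ Sym.sep :: u) := by
  induction h : S .inp generalizing S with
  | nil =>
    refine wp_loop.2 (wp_pop.2 ?_)
    rw [h]
    exact wp_exit.2 (.inr ⟨rfl, by omega, by simp⟩)
  | cons a w ih =>
    -- The common treatment of the two cases in which the symbol read is a bit.
    have hbit : ∀ b : Sym, b.isBit → a = b → wp (.push k b) (update S .inp w) fun t =>
        loopPost (.pop .inp fun
          | some .zero => .push k .zero
          | some .one => .push k .one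
          | some .sep => .push k .sep ;; .exit .brk
          | _ => .exit .rej) (fun t r S' => (r = .next ∧ ∃ row u, (∀ b ∈ row, b.isBit) ∧
            a :: w = row ++ Sym.sep :: u ∧
            S' = update (update S .inp u) k (Sym.sep :: (row.reverse ++ S k)) ∧
            t + 3 * u.length ≤ 3 * (a :: w).length) ∨
          (r = .rej ∧ t ≤ 3 * (a :: w).length + 2 ∧
            ∀ row u, (∀ b ∈ row, b.isBit) → a :: w ≠ row ++ Sym.sep :: u)) (t + 1) := by
      rintro b hb rfl
      refine wp_push.2 (wp.mono (ih _ (by simp [hk.symm])) ?_)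
      rintro t r S' (⟨rfl, row, u, hrow, rfl, rfl, ht⟩ | ⟨rfl, ht, hw⟩)
      · refine .inl ⟨rfl, a :: row, u, ?_, by simp, ?_, by simp at ht ⊢; omega⟩
        · simpa [hb] using hrow
        · funext i
          by_cases e₁ : i = k <;> by_cases e₂ : i = .inp <;> simp_all
      · refine .inr ⟨rfl, by simp; omega, ?_⟩
        rintro (_ | ⟨c, row⟩) u hrow h'
        · simp only [List.nil_append, List.cons.injEq] at h'
          rw [h'.1] at hb
          exact absurd hb (by decide)
        · simp only [List.cons_append, List.cons.injEq] at h'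
          exact hw row u (fun b hb => hrow b (List.mem_cons_of_mem _ hb)) h'.2
    refine wp_loop.2 (wp_pop.2 ?_)
    rw [h]
    cases a with
    | zero => exact hbit .zero rfl rfl
    | one => exact hbit .one rfl rfl
    | sep =>
      refine wp_seq.2 (wp_push.2 (wp_exit.2 (.inl ⟨rfl, [], w, by simp, by simp, ?_, ?_⟩)))
      · simp [hk]
      · simp only [List.length_cons]
        omega
    | _ =>
      refine wp_exit.2 (.inr ⟨rfl, by omega, ?_⟩)
      rintro (_ | ⟨c, row⟩) u hrow h'
      · simp at h'
      · simp only [List.cons_append, List.cons.injEq] at h'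
        have := hrow c List.mem_cons_self
        rw [← h'.1] at this
        exact absurd this (by decide)

/-- Read the data of a world whose first bit is `b`. -/
def readWorld (b : Sym) : Program := .push .team2 b ;; readRow .colA ;; readRow .colB

theorem wp_readWorld (b : Sym) (S : Stacks) :
    wp (readWorld b) S fun t r S' =>
      (r = .next ∧ ∃ row row' u, (∀ b ∈ row, b.isBit) ∧ (∀ b ∈ row', b.isBit) ∧
        S .inp = row ++ Sym.sep :: (row' ++ Sym.sep :: u) ∧
        S' = update (update (update (update S .inp u) .team2 (b :: S .team2))
          .colA (Sym.sep :: (row.reverse ++ S .colA)))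
          .colB (Sym.sep :: (row'.reverse ++ S .colB)) ∧
        t + 3 * u.length ≤ 3 * (S .inp).length + 1) ∨
      (r = .rej ∧ t ≤ 3 * (S .inp).length + 3 ∧
        ∀ row row' u, (∀ b ∈ row, b.isBit) → (∀ b ∈ row', b.isBit) →
          S .inp ≠ row ++ Sym.sep :: (row' ++ Sym.sep :: u)) := by
  refine wp_seq.2 (wp_push.2 (wp_seq.2 (wp.mono (wp_readRow (by simp) _) ?_)))
  simp only [ne_eq, reduceCtorEq, not_false_eq_true, update_of_ne]
  rintro t r S' (⟨rfl, row, u, hrow, hS, rfl, ht⟩ | ⟨rfl, ht, hw⟩)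
  · refine wp.mono (wp_readRow (by simp) _) ?_
    simp only [ne_eq, reduceCtorEq, not_false_eq_true, update_of_ne, update_self]
    rintro t' r S' (⟨rfl, row', u', hrow', hS', rfl, ht'⟩ | ⟨rfl, ht', hw'⟩)
    · refine .inl ⟨rfl, row, row', u', hrow, hrow', by rw [hS, hS'], ?_, by omega⟩
      funext k
      cases k <;> simp
    · refine .inr ⟨rfl, by omega, fun r₁ r₂ v h₁ h₂ h => ?_⟩
      rw [hS] at h
      exact hw' r₂ v h₂ (row_append_inj hrow h₁ h).2
  · exact .inr ⟨rfl, by omega, fun r₁ r₂ v h₁ h₂ h => hw r₁ _ h₁ h⟩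

/-- Read the data of the worlds. -/
def readWorlds : Program :=
  .loop (.pop .inp fun
    | none => .exit .brk
    | some b => if b.isBit then readWorld b else .push .inp b ;; .exit .brk)

/-- By `row_append_inj` every decomposition of the input has to start with the rows just read, so a
failure further on excludes all decompositions. Each world consumes input, hence the induction on
its length. -/
theorem wp_readWorlds (S : Stacks) :
    wp readWorlds S fun t r S' => t ≤ 3 * (S .inp).length + 3 ∧
      ((r = .next ∧ ∃ (l : List WorldData) (u : List Sym), (∀ x ∈ l, x.IsBits) ∧ EndsWorlds u ∧
        S .inp = l.flatMap worldWord ++ u ∧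
        S' = update (update (update (update S .inp u) .team2 ((l.map (·.1)).reverse ++ S .team2))
          .colA ((l.flatMap fun x => x.2.1 ++ [Sym.sep]).reverse ++ S .colA))
          .colB ((l.flatMap fun x => x.2.2 ++ [Sym.sep]).reverse ++ S .colB)) ∨
      (r = .rej ∧ ∀ (l : List WorldData) (u : List Sym), (∀ x ∈ l, x.IsBits) → EndsWorlds u →
        S .inp ≠ l.flatMap worldWord ++ u)) := by
  induction hn : (S .inp).length using Nat.strong_induction_on generalizing S with
  | _ n ih =>
  refine wp_loop.2 (wp_pop.2 ?_)
  cases h : S .inp with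
  | nil =>
    refine wp_exit.2 ⟨by omega, .inl ⟨rfl, [], [], by simp, by simp [EndsWorlds], rfl, ?_⟩⟩
    funext k
    cases k <;> simp
  | cons b w =>
    subst hn
    simp only [h, List.length_cons] at ih ⊢
    by_cases hb : b.isBit
    · simp only [List.head?_cons, List.tail_cons, hb, if_true]
      refine wp.mono (wp_readWorld b _) ?_
      simp only [ne_eq, reduceCtorEq, not_false_eq_true, update_of_ne, update_self]
      rintro t r S' (⟨rfl, row, row', u, hrow, hrow', rfl, rfl, ht⟩ | ⟨rfl, ht, hw⟩)
      · refine wp.mono (ih _ ?_ _ rfl) ?_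
        · simp
          omega
        simp only [ne_eq, reduceCtorEq, not_false_eq_true, update_of_ne, update_self]
        rintro t' r S' ⟨ht', h'⟩
        refine ⟨by omega, h'.imp ?_ ?_⟩
        · rintro ⟨rfl, l, v, hl, hv, rfl, rfl⟩
          refine ⟨rfl, (b, row, row') :: l, v, ?_, hv, by simp [worldWord], ?_⟩
          · exact List.forall_mem_cons.2 ⟨⟨hb, hrow, hrow'⟩, hl⟩
          · funext k
            cases k <;> simp
        · rintro ⟨rfl, hw⟩
          refine ⟨rfl, ?_⟩
          rintro (_ | ⟨x, l⟩) v hl hv hlv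
          · rw [List.flatMap_nil, List.nil_append] at hlv
            have := hv b (by rw [← hlv]; rfl)
            simp [hb] at this
          · obtain ⟨hx₁, hx₂, hx₃⟩ := hl x List.mem_cons_self
            simp only [List.flatMap_cons, worldWord, List.cons_append, List.append_assoc,
              List.cons.injEq, List.nil_append] at hlv
            obtain ⟨-, h₂⟩ := row_append_inj hrow hx₂ hlv.2
            obtain ⟨-, h₃⟩ := row_append_inj hrow' hx₃ h₂
            exact hw l v (fun y hy => hl y (List.mem_cons_of_mem _ hy)) hv h₃
      · refine ⟨by omega, .inr ⟨rfl, ?_⟩⟩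
        rintro (_ | ⟨x, l⟩) v hl hv hlv
        · rw [List.flatMap_nil, List.nil_append] at hlv
          have := hv b (by rw [← hlv]; rfl)
          simp [hb] at this
        · obtain ⟨hx₁, hx₂, hx₃⟩ := hl x List.mem_cons_self
          simp only [List.flatMap_cons, worldWord, List.cons_append, List.append_assoc,
            List.cons.injEq, List.nil_append] at hlv
          exact hw _ _ _ hx₂ hx₃ hlv.2
    -- The symbol read is not a bit: it belongs to the remainder and goes back on the input.
    · simp only [List.head?_cons, List.tail_cons, hb]
      refine wp_seq.2 (wp_push.2 (wp_exit.2
        ⟨by omega, .inl ⟨rfl, [], b :: w, by simp, ?_, rfl, ?_⟩⟩))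
      · simpa [EndsWorlds] using hb
      · funext k
        cases k <;> simp

/-- Read the data of the worlds, and distribute them to the stacks. -/
def readModel : Program :=
  readWorlds ;; move .team2 .team ;; move .colA .rel ;; move .colB .lab

theorem wp_readModel (w : List Sym) :
    wp readModel (initStore .inp w) fun t r S' => t ≤ 9 * w.length + 9 ∧
      ((r = .next ∧ ∃ (l : List WorldData) (u : List Sym), (∀ x ∈ l, x.IsBits) ∧ EndsWorlds u ∧
        w = l.flatMap worldWord ++ u ∧
        S' = update (update (update (initStore .inp u) .team (l.map (·.1)))
          .rel (l.flatMap fun x => x.2.1 ++ [Sym.sep]))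
          .lab (l.flatMap fun x => x.2.2 ++ [Sym.sep])) ∨
      (r = .rej ∧ ∀ (l : List WorldData) (u : List Sym), (∀ x ∈ l, x.IsBits) → EndsWorlds u →
        w ≠ l.flatMap worldWord ++ u)) := by
  refine wp_seq.2 (wp.mono (wp_readWorlds _) ?_)
  simp only [initStore, update_self]
  rintro t r S' ⟨ht, ⟨rfl, l, u, hl, hu, rfl, rfl⟩ | ⟨rfl, hw⟩⟩
  · refine wp.mono ((ends_move (by simp) _).seq ((ends_move (by simp) _).seq
      (ends_move (by simp) _))) ?_
    rintro t' r S' ⟨ht', rfl, rfl⟩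
    -- The three stacks together hold exactly the symbols of the world words, which bounds the cost
    -- of moving them.
    have hlen : (l.map (·.1)).length + (l.flatMap fun x => x.2.1 ++ [Sym.sep]).length +
        (l.flatMap fun x => x.2.2 ++ [Sym.sep]).length = (l.flatMap worldWord).length := by
      clear * -
      induction l with
      | nil => rfl
      | cons x l ih =>
        simp [worldWord] at ih ⊢
        omega
    refine ⟨?_, .inl ⟨rfl, l, u, hl, hu, rfl, ?_⟩⟩
    · simp only [ne_eq, reduceCtorEq, not_false_eq_true, update_of_ne, update_self,
        List.append_nil, List.length_reverse] at ht'
      rw [List.length_append] at ht ⊢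
      omega
    · funext k
      cases k <;> simp
  · exact ⟨by omega, .inr ⟨rfl, hw⟩⟩

end MDL

/-! ### From raw rows to a Kripke structure: the shape check. -/

namespace MDL

open StackProgram

/-- The row of the accessibility relation for the world `i`. -/
noncomputable def relRow {n m : ℕ} (W : KripkeStructure (Fin n) (Fin m)) (i : Fin n) : List Sym :=
  (List.finRange n).map fun j => bit (W.rel i j)

/-- The row of the labeling function for the world `i`. -/
noncomputable def labRow {n m : ℕ} (W : KripkeStructure (Fin n) (Fin m)) (i : Fin n) : List Sym :=
  (List.finRange m).map fun p => bit (p ∈ W.label i)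

/-- A team as a vector of bits. -/
noncomputable def teamVec {n : ℕ} (T : Set (Fin n)) : List Sym :=
  (List.finRange n).map fun i => bit (i ∈ T)

/-- The data of the world `i`. -/
noncomputable def worldData {n m : ℕ} (W : KripkeStructure (Fin n) (Fin m)) (T : Set (Fin n))
    (i : Fin n) : WorldData := (bit (i ∈ T), relRow W i, labRow W i)

section Model

variable {n m : ℕ} (W : KripkeStructure (Fin n) (Fin m)) (T : Set (Fin n))

theorem worldWord_worldData (i : Fin n) : worldWord (worldData W T i) = codeWorld W T i := by
  simp [worldWord, worldData, codeWorld, relRow, labRow, List.ofFn_eq_map]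

theorem isBits_worldData (i : Fin n) : (worldData W T i).IsBits := by
  refine ⟨isBit_bit _, ?_, ?_⟩ <;> simp [worldData, relRow, labRow, isBit_bit]

theorem isBit_relRow (i : Fin n) : ∀ b ∈ relRow W i, b.isBit :=
  (isBits_worldData W ∅ i).2.1

theorem isBit_labRow (i : Fin n) : ∀ b ∈ labRow W i, b.isBit :=
  (isBits_worldData W ∅ i).2.2

/-- Data of worlds of the right shape describe a Kripke structure and a team. -/
theorem exists_worldData {l : List WorldData} (hl : ∀ x ∈ l, x.IsBits) (h0 : l ≠ [])
    (hrel : ∀ x ∈ l, x.2.1.length = l.length) {m : ℕ} (hlab : ∀ x ∈ l, x.2.2.length = m) :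
    ∃ (W : KripkeStructure (Fin l.length) (Fin m)) (T : Set (Fin l.length)),
      l = (List.finRange l.length).map (worldData W T) := by
  have hpos := List.length_pos_iff.2 h0
  -- The optional lookup spares proofs that the indices are in range; the assumption `h0` supplies
  -- the world that a structure must have.
  refine ⟨⟨⟨⟨0, hpos⟩⟩, fun i j => l[i].2.1[(j : ℕ)]? = some .one,
    fun i => {p | l[i].2.2[(p : ℕ)]? = some .one}⟩, {i | l[i].1 = .one}, ?_⟩
  refine List.ext_getElem (by simp) fun i hi hi' => ?_
  have hx := List.getElem_mem hi
  obtain ⟨h₁, h₂, h₃⟩ := hl _ hx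
  have h₄ := hrel _ hx
  have h₅ := hlab _ hx
  simp only [List.getElem_map, List.getElem_finRange, worldData, relRow, labRow]
  refine Prod.ext (bit_eq_one_of_isBit h₁).symm (Prod.ext ?_ ?_)
  · refine List.ext_getElem (by simp [h₄]) fun j hj hj' => ?_
    have := bit_eq_one_of_isBit (h₂ _ (List.getElem_mem hj))
    simp [List.getElem?_eq_getElem hj, this]
  · refine List.ext_getElem (by simp [h₅]) fun j hj hj' => ?_
    have := bit_eq_one_of_isBit (h₃ _ (List.getElem_mem hj))
    simp [List.getElem?_eq_getElem hj, this]

/-- The contents of the stacks when the formulas coded by `u` are to be evaluated in the teams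
`Ts`. -/
noncomputable def modelStacks (u : List Sym) (Ts : List (Set (Fin n))) : Stacks
  | .inp => u
  | .teams => Ts.flatMap fun T => (teamVec T).reverse ++ [Sym.sep]
  | .rel => (List.finRange n).flatMap fun i => relRow W i ++ [Sym.sep]
  | .lab => (List.finRange n).flatMap fun i => labRow W i ++ [Sym.sep]
  | .zer => List.replicate m .zero
  | _ => []

end Model

/-- Disjunction of bits, where the third argument is combined with a condition. -/
noncomputable def orAnd (t a b : Sym) : Sym := bit (a = .one ∨ t = .one ∧ b = .one)

/-- Copy the first row of the labeling function to `vec`. -/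
def copyFirstRow : Program :=
  .loop (.pop .lab fun
    | none => .exit .rej
    | some .sep => .push .lab .sep ;; .exit .brk
    | some b => .push .out b ;; .push .vec b) ;;
  move .out .lab

theorem ends_copyFirstRow {row u : List Sym} (hrow : ∀ b ∈ row, b.isBit) {S : Stacks}
    (hS : S .lab = row ++ Sym.sep :: u) (hO : S .out = []) :
    Ends copyFirstRow S (5 * row.length + 5) (update S .vec (row.reverse ++ S .vec)) := by
  have key : ∀ (row : List Sym) (S : Stacks), (∀ b ∈ row, b.isBit) →
      S .lab = row ++ Sym.sep :: u → Ends (.loop (.pop .lab fun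
        | none => .exit .rej
        | some .sep => .push .lab .sep ;; .exit .brk
        | some b => .push .out b ;; .push .vec b)) S (3 * row.length + 3)
        (update (update (update S .lab (Sym.sep :: u)) .out (row.reverse ++ S .out))
          .vec (row.reverse ++ S .vec)) := by
    intro row
    induction row with
    | nil =>
      intro S _ hS
      refine wp_loop.2 (wp_pop.2 ?_)
      rw [hS]
      refine wp_seq.2 (wp_push.2 (wp_exit.2 ⟨by simp, rfl, ?_⟩))
      funext k
      cases k <;> simp
    | cons a row ih =>
      intro S hrow hS
      refine (Ends.loop (ends_pop (B := 2) (o := some a) (l := row ++ Sym.sep :: u)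
        (S₁ := update (update (update S .lab (row ++ Sym.sep :: u)) .out (a :: S .out))
          .vec (a :: S .vec)) (by simp [hS]) (by simp [hS]) ?_)
        (ih _ (fun b hb => hrow b (List.mem_cons_of_mem _ hb)) (by simp))).congr ?_ ?_
      · have ha := hrow a List.mem_cons_self
        have : Ends (.push .out a ;; .push .vec a) (update S .lab (row ++ Sym.sep :: u)) 2
            (update (update (update S .lab (row ++ Sym.sep :: u)) .out (a :: S .out))
              .vec (a :: S .vec)) :=
          ((ends_push _ _).seq (ends_push _ _)).congr (by omega) (by simp)
        cases a <;> first | exact this | exact absurd ha (by decide)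
      · simp only [List.length_cons]
        omega
      · funext k
        cases k <;> simp
  refine ((key row S hrow hS).seq (ends_move (by simp) _)).congr ?_ ?_
  · simp [hO]
    omega
  · funext k
    cases k <;> simp [hO, hS]

/-- Check that the matrices have the right shape, and prepare the other stacks. -/
noncomputable def checkShape : Program :=
  .pop .team (fun
    | none => .exit .rej
    | some b => .push .team b) ;;
  -- Both sweeps serve only to compare lengths with `vec`: first with the number of worlds, then
  -- with the length of the first labeling row, which is taken as `m`. The entries of `vec` are
  -- discarded or overwritten by zeros.
  copyMap id .team .team2 .vec ;;
  sweep orAnd (fun _ => false) .rel ;;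
  clear .vec ;;
  copyFirstRow ;;
  sweep orAnd (fun _ => false) .lab ;;
  moveMap (fun _ => .zero) .vec .zer ;;
  .push .teams .sep ;;
  move .team .teams

section SweepResult

variable {ι : Type*} {f : Sym → Sym → Sym → Sym} {t : ι → Sym} {row : ι → List Sym}

theorem sweepResult_false_snd (l : List ι) (v o : List Sym) :
    (sweepResult f (fun _ => false) t row l v o).2 = o := by
  induction l generalizing v with
  | nil => rfl
  | cons i l ih => simp [sweepResult, selected, ih]

theorem length_sweepResult {g : Sym → Bool} (l : List ι) (v o : List Sym)
    (hl : ∀ i ∈ l, (row i).length = v.length) :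
    (sweepResult f g t row l v o).1.length = v.length := by
  induction l generalizing v o with
  | nil => rfl
  | cons i l ih =>
    have hi := hl i List.mem_cons_self
    rw [sweepResult, ih _ _ fun j hj => ?_, List.length_zipWith, hi, min_self]
    rw [List.length_zipWith, hi, min_self, hl j (List.mem_cons_of_mem _ hj)]

end SweepResult

theorem length_le_flatMap {α β : Type*} (l : List α) (F : α → List β) {x : α} (hx : x ∈ l) :
    (F x).length ≤ (l.flatMap F).length := by
  rw [List.length_flatMap]
  exact List.le_sum_of_mem (List.mem_map_of_mem hx)

/-- The data describe a model exactly if there is a world, the rows of the relation are as long as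
the list, and the labeling rows have a common length. Sufficiency is `exists_worldData`; necessity,
which justifies rejection, is `hshape` below. -/
theorem wp_checkShape {l : List WorldData} {u : List Sym} (hl : ∀ x ∈ l, x.IsBits) {N : ℕ}
    (hN : (l.flatMap worldWord).length ≤ N) :
    wp checkShape (update (update (update (initStore .inp u) .team (l.map (·.1)))
          .rel (l.flatMap fun x => x.2.1 ++ [Sym.sep]))
          .lab (l.flatMap fun x => x.2.2 ++ [Sym.sep])) fun t r S' =>
      t ≤ 60 * (N + 1) ^ 2 ∧
      ((r = .next ∧ ∃ n m, ∃ (W : KripkeStructure (Fin n) (Fin m)) (T : Set (Fin n)),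
          l = (List.finRange n).map (worldData W T) ∧ S' = modelStacks W u [T]) ∨
        (r = .rej ∧ ∀ n m, ∀ (W : KripkeStructure (Fin n) (Fin m)) (T : Set (Fin n)),
          l ≠ (List.finRange n).map (worldData W T))) := by
  have rejected : ∀ {p : Program} {S : Stacks} {B : ℕ}, Rejects p S B → B ≤ 60 * (N + 1) ^ 2 →
      (∀ n m, ∀ (W : KripkeStructure (Fin n) (Fin m)) (T : Set (Fin n)),
        l ≠ (List.finRange n).map (worldData W T)) →
      wp p S fun t r S' => t ≤ 60 * (N + 1) ^ 2 ∧
      ((r = .next ∧ ∃ n m, ∃ (W : KripkeStructure (Fin n) (Fin m)) (T : Set (Fin n)),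
          l = (List.finRange n).map (worldData W T) ∧ S' = modelStacks W u [T]) ∨
        (r = .rej ∧ ∀ n m, ∀ (W : KripkeStructure (Fin n) (Fin m)) (T : Set (Fin n)),
          l ≠ (List.finRange n).map (worldData W T))) :=
    fun h hB hw => wp.mono h fun t r S' h' => ⟨h'.1.trans hB, .inr ⟨h'.2, hw⟩⟩
  cases hl0 : l with
  | nil =>
    rw [← hl0]
    -- Without worlds there is no model, because the set of worlds of a Kripke structure is
    -- non-empty.
    refine rejected (Rejects.seq (rejects_pop (o := none) (l := []) (by simp [hl0])
      (by simp [hl0]) rejects_exit)) (by nlinarith) ?_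
    rintro n m W T h
    rw [hl0] at h
    have := congrArg List.length h
    simp only [List.length_nil, List.length_map, List.length_finRange] at this
    subst this
    exact W.nonempty.elim fun i => i.elim0
  | cons x₀ l₀ =>
    have hx₀ : x₀ ∈ l := by simp [hl0]
    have hlen : l.length ≤ N := by
      refine le_trans ?_ hN
      rw [List.length_flatMap]
      have : (l.map fun x => 1).sum ≤ (l.map fun x => (worldWord x).length).sum :=
        List.sum_le_sum fun x _ => by simp [worldWord]
      simpa using this
    have hm : x₀.2.2.length ≤ N := by
      refine le_trans ?_ ((length_le_flatMap l worldWord hx₀).trans hN)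
      simp [worldWord]
      omega
    rw [← hl0]
    generalize hM : (update (update (update (initStore .inp u) .team (l.map (·.1)))
      .rel (l.flatMap fun x => x.2.1 ++ [Sym.sep]))
      .lab (l.flatMap fun x => x.2.2 ++ [Sym.sep]) : Stacks) = M
    have hT : M .team = l.map (·.1) := by simp [← hM]
    have hR : M .rel = l.flatMap fun x => x.2.1 ++ [Sym.sep] := by simp [← hM]
    have hL : M .lab = l.flatMap fun x => x.2.2 ++ [Sym.sep] := by simp [← hM]
    have hI : M .inp = u := by simp [← hM, initStore]
    have hO : ∀ k, k ≠ .team → k ≠ .rel → k ≠ .lab → k ≠ .inp → M k = [] := by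
      intro k h₁ h₂ h₃ h₄
      simp [← hM, initStore, h₁, h₂, h₃, h₄]
    clear hM
    have hhead : Ends (.pop .team (fun
        | none => .exit .rej
        | some b => .push .team b) : Program) M 2 M := by
      refine ends_pop (o := some x₀.1) (l := l₀.map (·.1)) (by simp [hT, hl0]) (by simp [hT, hl0])
        ((ends_push _ _).congr le_rfl ?_)
      funext k
      cases k <;> simp [hT, hl0]
    have hcopy : Ends (copyMap id .team .team2 .vec : Program) M (5 * N + 4)
        (update M .vec (l.map (·.1)).reverse) := by
      refine (ends_copyMap id (k := Var.team) (h := Var.team2) (k' := Var.vec)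
        (by simp) (by simp) (by simp) _ (by simp [hO])).congr ?_ ?_
      · simp only [hT, List.length_map]
        omega
      · simp [hT, hO]
    have hprod : ∀ a b, a ≤ N → b ≤ N → 12 * ((a + 1) * (b + 1)) ≤ 12 * (N + 1) ^ 2 := by
      intro a b ha hb
      rw [pow_two]
      exact Nat.mul_le_mul_left _ (Nat.mul_le_mul (by omega) (by omega))
    have hsq : (N + 1) ^ 2 = N * N + 2 * N + 1 := by ring
    have hbits₁ : ∀ x ∈ l, ∀ b ∈ x.2.1, b.isBit := fun x hx => (hl x hx).2.1
    have hbits₂ : ∀ x ∈ l, ∀ b ∈ x.2.2, b.isBit := fun x hx => (hl x hx).2.2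
    have hshape : ∀ n m, ∀ (W : KripkeStructure (Fin n) (Fin m)) (T : Set (Fin n)),
        l = (List.finRange n).map (worldData W T) →
          (∀ x ∈ l, x.2.1.length = l.length) ∧ ∀ x ∈ l, x.2.2.length = x₀.2.2.length := by
      intro n m W T h
      have h₁ : l.length = n := by simp [h]
      have h₂ : ∀ x ∈ l, x.2.1.length = n ∧ x.2.2.length = m := by
        intro x hx
        rw [h] at hx
        obtain ⟨i, -, rfl⟩ := List.mem_map.1 hx
        simp [worldData, relRow, labRow]
      exact ⟨fun x hx => by rw [h₁, (h₂ x hx).1],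
        fun x hx => by rw [(h₂ x hx).2, (h₂ x₀ hx₀).2]⟩
    by_cases hrel : ∀ x ∈ l, x.2.1.length = l.length
    swap
    · refine rejected (hhead.seq_rejects (hcopy.seq_rejects (Rejects.seq
        ((rejects_sweep (.inl rfl) (l := l) (t := (·.1)) (row := (·.2.1))
          (v := (l.map (·.1)).reverse) (by simp [hT]) (by simp) (by simp [hR]) (by simp [hO])
          hbits₁ ?_).mono (hprod _ _ hlen ?_))))) (by omega)
        fun n m W T h => hrel (hshape n m W T h).1
      · push Not at hrel
        simpa using hrel
      · simpa using hlen
    -- Only the length of the new `vec` is remembered, for the cost of clearing it.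
    obtain ⟨v, hv, hsweep_rel⟩ : ∃ v : List Sym, v.length = l.length ∧
        Ends (sweep orAnd (fun _ => false) .rel) (update M .vec (l.map (·.1)).reverse)
          (12 * (N + 1) ^ 2)
          (update M .vec v) := by
      refine ⟨(sweepResult orAnd (fun _ => false) (·.1) (·.2.1) l (l.map (·.1)).reverse []).1, ?_,
        (ends_sweep (.inl rfl) (l := l) (t := (·.1)) (row := (·.2.1))
          (v := (l.map (·.1)).reverse) (by simp [hT]) (by simp) (by simp [hR])
          (by simp [hO]) (by simp [hO]) (by simp [hO]) hbits₁ (by simpa using hrel)).congr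
          (hprod _ _ hlen (by simpa using hlen)) ?_⟩
      · rw [length_sweepResult _ _ _ (by simpa using hrel)]
        simp
      · funext k
        cases k <;> simp [hO, sweepResult_false_snd]
    have hclear : Ends (clear .vec : Program) (update M .vec v) (2 * N + 2) M := by
      refine (ends_clear _).congr (by simp; omega) ?_
      funext k
      cases k <;> simp [hO]
    have hfirst : Ends copyFirstRow M (5 * N + 5) (update M .vec x₀.2.2.reverse) := by
      refine (ends_copyFirstRow (row := x₀.2.2) (u := l₀.flatMap fun x => x.2.2 ++ [Sym.sep])
        (hbits₂ x₀ hx₀) ?_ ?_).congr (by omega) ?_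
      · simp [hL, hl0]
      · simp [hO]
      · simp [hO]
    have hstart := fun {p : Program} {B : ℕ} {S : Stacks} (h : Ends p _ B S) =>
      hhead.seq (hcopy.seq (hsweep_rel.seq (hclear.seq (hfirst.seq h))))
    by_cases hlab : ∀ x ∈ l, x.2.2.length = x₀.2.2.length
    swap
    · refine rejected (hhead.seq_rejects (hcopy.seq_rejects (hsweep_rel.seq_rejects
        (hclear.seq_rejects (hfirst.seq_rejects (Rejects.seq
        ((rejects_sweep (.inr rfl) (l := l) (t := (·.1)) (row := (·.2.2))
          (v := x₀.2.2.reverse) (by simp [hT]) (by simp) (by simp [hL]) (by simp [hO])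
          hbits₂ ?_).mono (hprod _ _ hlen ?_)))))))) (by omega)
        fun n m W T h => hlab (hshape n m W T h).2
      · push Not at hlab
        simpa using hlab
      · simpa using hm
    obtain ⟨v', hv', hsweep_lab⟩ : ∃ v : List Sym, v.length = x₀.2.2.length ∧
        Ends (sweep orAnd (fun _ => false) .lab) (update M .vec x₀.2.2.reverse) (12 * (N + 1) ^ 2)
          (update M .vec v) := by
      refine ⟨(sweepResult orAnd (fun _ => false) (·.1) (·.2.2) l x₀.2.2.reverse []).1, ?_,
        (ends_sweep (.inr rfl) (l := l) (t := (·.1)) (row := (·.2.2))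
          (v := x₀.2.2.reverse) (by simp [hT]) (by simp) (by simp [hL])
          (by simp [hO]) (by simp [hO]) (by simp [hO]) hbits₂ (by simpa using hlab)).congr
          (hprod _ _ hlen (by simpa using hm)) ?_⟩
      · rw [length_sweepResult _ _ _ (by simpa using hlab)]
        simp
      · funext k
        cases k <;> simp [hO, sweepResult_false_snd]
    obtain ⟨W, T, hW⟩ := exists_worldData hl (by simp [hl0]) hrel hlab
    refine wp.mono (hstart (hsweep_lab.seq ((ends_moveMap (fun _ => Sym.zero)
      (k := Var.vec) (k' := Var.zer) (by simp) _).seq ((ends_push _ _).seq (ends_move (k := Var.team) (k' := Var.teams)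
      (by simp) _))))) ?_
    rintro t r S' ⟨ht, rfl, rfl⟩
    refine ⟨ht.trans ?_, .inl ⟨rfl, _, _, W, T, hW, ?_⟩⟩
    · simp [hO, hT, hv']
      omega
    · have h₁ : l.map (·.1) = teamVec T := by
        conv_lhs => rw [hW]
        simp [worldData, teamVec]
      have h₂ : (l.flatMap fun x => x.2.1 ++ [Sym.sep]) =
          (List.finRange l.length).flatMap fun i => relRow W i ++ [Sym.sep] := by
        conv_lhs => rw [hW]
        simp [worldData, List.flatMap_map]
      have h₃ : (l.flatMap fun x => x.2.2 ++ [Sym.sep]) =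
          (List.finRange l.length).flatMap fun i => labRow W i ++ [Sym.sep] := by
        conv_lhs => rw [hW]
        simp [worldData, List.flatMap_map]
      funext k
      cases k <;>
        simp [hO, hT, hR, hL, hI, modelStacks, h₁, h₂, h₃, hv',
          List.map_const']

end MDL

namespace MDL

open StackProgram

variable {n m : ℕ}

/-! ### Unique readability -/

theorem codeProp_append_inj {p q : Fin m} {u v : List Sym}
    (h : codeProp p ++ u = codeProp q ++ v) : p = q ∧ u = v := by
  simp only [codeProp, List.cons_append, List.append_assoc, List.cons.injEq, List.nil_append,
    true_and] at h
  obtain ⟨h₁, h₂⟩ := row_append_inj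
    (fun b hb => by rw [List.eq_of_mem_replicate hb]; rfl)
    (fun b hb => by rw [List.eq_of_mem_replicate hb]; rfl) h
  have := congrArg List.length h₁
  simp only [List.length_replicate] at this
  exact ⟨Fin.ext this, h₂⟩

theorem codeProps_append_inj {ps qs : List (Fin m)} {u v : List Sym}
    (h : ps.flatMap codeProp ++ Sym.sep :: u = qs.flatMap codeProp ++ Sym.sep :: v) :
    ps = qs ∧ u = v := by
  induction ps generalizing qs with
  | nil =>
    cases qs with
    | nil => simpa using h
    | cons q qs => simp [codeProp] at h
  | cons p ps ih =>
    cases qs with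
    | nil => simp [codeProp] at h
    | cons q qs =>
      simp only [List.flatMap_cons, List.append_assoc] at h
      obtain ⟨rfl, h'⟩ := codeProp_append_inj h
      obtain ⟨rfl, rfl⟩ := ih h'
      exact ⟨rfl, rfl⟩

theorem codeDep_append_inj {ps qs : List (Fin m)} {p q : Fin m} {u v : List Sym}
    (h : codeDep ps p ++ u = codeDep qs q ++ v) : ps = qs ∧ p = q ∧ u = v := by
  simp only [codeDep, List.cons_append, List.append_assoc, List.cons.injEq, true_and] at h
  obtain ⟨rfl, h'⟩ := codeProps_append_inj h
  exact ⟨rfl, codeProp_append_inj h'⟩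

/-- The first symbol, or the second one after `neg`, determines the outermost constructor. Since the
remainders are arbitrary in the induction, the first argument of a binary operator can be split off
without delimiters. -/
theorem Formula.code_append_inj {φ ψ : Formula (Fin m)} {u v : List Sym}
    (h : φ.code ++ u = ψ.code ++ v) : φ = ψ ∧ u = v := by
  induction φ generalizing ψ u v with
  | top => cases ψ <;> simp_all [code, codeProp, codeDep]
  | bot => cases ψ <;> simp_all [code, codeProp, codeDep]
  | atom p =>
    cases ψ with
    | atom q =>
      obtain ⟨rfl, rfl⟩ := codeProp_append_inj h
      exact ⟨rfl, rfl⟩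
    | _ => simp [code, codeProp, codeDep] at h
  | negAtom p =>
    cases ψ with
    | negAtom q =>
      obtain ⟨rfl, rfl⟩ := codeProp_append_inj (List.cons.inj h).2
      exact ⟨rfl, rfl⟩
    | _ => simp [code, codeProp, codeDep] at h
  | dep ps p =>
    cases ψ with
    | dep qs q =>
      obtain ⟨rfl, rfl, rfl⟩ := codeDep_append_inj h
      exact ⟨rfl, rfl⟩
    | _ => simp [code, codeProp, codeDep] at h
  | negDep ps p =>
    cases ψ with
    | negDep qs q =>
      obtain ⟨rfl, rfl, rfl⟩ := codeDep_append_inj (List.cons.inj h).2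
      exact ⟨rfl, rfl⟩
    | _ => simp [code, codeProp, codeDep] at h
  | and φ₁ φ₂ ih₁ ih₂ =>
    cases ψ with
    | and ψ₁ ψ₂ =>
      simp only [code, List.cons_append, List.append_assoc, List.cons.injEq, true_and] at h
      obtain ⟨rfl, h'⟩ := ih₁ h
      obtain ⟨rfl, rfl⟩ := ih₂ h'
      exact ⟨rfl, rfl⟩
    | _ => simp [code, codeProp, codeDep] at h
  | or φ₁ φ₂ ih₁ ih₂ =>
    cases ψ with
    | or ψ₁ ψ₂ =>
      simp only [code, List.cons_append, List.append_assoc, List.cons.injEq, true_and] at h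
      obtain ⟨rfl, h'⟩ := ih₁ h
      obtain ⟨rfl, rfl⟩ := ih₂ h'
      exact ⟨rfl, rfl⟩
    | _ => simp [code, codeProp, codeDep] at h
  | cor φ₁ φ₂ ih₁ ih₂ =>
    cases ψ with
    | cor ψ₁ ψ₂ =>
      simp only [code, List.cons_append, List.append_assoc, List.cons.injEq, true_and] at h
      obtain ⟨rfl, h'⟩ := ih₁ h
      obtain ⟨rfl, rfl⟩ := ih₂ h'
      exact ⟨rfl, rfl⟩
    | _ => simp [code, codeProp, codeDep] at h
  | box φ ih =>
    cases ψ with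
    | box ψ =>
      obtain ⟨rfl, rfl⟩ := ih (List.cons.inj h).2
      exact ⟨rfl, rfl⟩
    | _ => simp [code, codeProp, codeDep] at h
  | dia φ ih =>
    cases ψ with
    | dia ψ =>
      obtain ⟨rfl, rfl⟩ := ih (List.cons.inj h).2
      exact ⟨rfl, rfl⟩
    | _ => simp [code, codeProp, codeDep] at h

/-! ### Columns of the labeling matrix -/

/-- The column of the labeling matrix for the proposition `p`. -/
noncomputable def column (W : KripkeStructure (Fin n) (Fin m)) (p : Fin m) : List Sym :=
  (List.finRange n).map fun i => bit (p ∈ W.label i)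

/-- The contents of the stacks during the evaluation of a literal in the team `T`. -/
noncomputable def litStacks (W : KripkeStructure (Fin n) (Fin m)) (u : List Sym)
    (Ts : List (Set (Fin n))) (T : Set (Fin n)) (E : List Sym) : Stacks :=
  update (update (modelStacks W u Ts) .team (teamVec T)) .pairs E

/-- Read an index in unary, moving as many entries from `zer` to `vec2`. -/
def readIndex : Program :=
  .loop (.pop .inp fun
    | some .one => .pop .zer fun
      | none => .exit .rej
      | some _ => .push .vec2 .zero
    | some .sep => .exit .brk
    | _ => .exit .rej)

theorem ne_index {a : Sym} (h₁ : a ≠ .one) (h₂ : a ≠ .sep) (w : List Sym) (p : ℕ)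
    (u : List Sym) : a :: w ≠ List.replicate p .one ++ Sym.sep :: u := by
  cases p <;> simp [List.replicate_succ, h₁, h₂]

/-- The zeros on `zer` count in unary how far the index may go. The index `p = j` still passes here,
although it names no proposition; `readMask` rejects it. -/
theorem wp_readIndex (j : ℕ) (S : Stacks) (hS : S .zer = List.replicate j .zero) :
    wp readIndex S fun t r S' => t ≤ 3 * j + 3 ∧
      ((r = .next ∧ ∃ p u, p ≤ j ∧ S .inp = List.replicate p .one ++ Sym.sep :: u ∧
        S' = update (update (update S .inp u) .zer (List.replicate (j - p) .zero))
          .vec2 (List.replicate p .zero ++ S .vec2)) ∨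
      (r = .rej ∧ ∀ p u, p ≤ j → S .inp ≠ List.replicate p .one ++ Sym.sep :: u)) := by
  induction j generalizing S with
  | zero =>
    refine wp_loop.2 (wp_pop.2 ?_)
    cases h : S .inp with
    | nil => exact wp_exit.2 ⟨by omega, .inr ⟨rfl, by simp⟩⟩
    | cons a w =>
      cases a with
      | one =>
        refine wp_pop.2 ?_
        simp only [ne_eq, reduceCtorEq, not_false_eq_true, update_of_ne, hS, List.replicate_zero,
          List.head?_nil]
        refine wp_exit.2 ⟨by omega, .inr ⟨rfl, ?_⟩⟩
        intro p u hp
        obtain rfl : p = 0 := by omega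
        simp
      | sep =>
        refine wp_exit.2 ⟨by omega, .inl ⟨rfl, 0, w, le_rfl, rfl, ?_⟩⟩
        funext k
        cases k <;> simp [hS]
      | _ => exact wp_exit.2 ⟨by omega, .inr ⟨rfl, fun p u _ => ne_index (by simp) (by simp) _ _ _⟩⟩
  | succ j ih =>
    refine wp_loop.2 (wp_pop.2 ?_)
    cases h : S .inp with
    | nil => exact wp_exit.2 ⟨by omega, .inr ⟨rfl, by simp⟩⟩
    | cons a w =>
      cases a with
      | one =>
        refine wp_pop.2 ?_
        simp only [ne_eq, reduceCtorEq, not_false_eq_true, update_of_ne, hS, List.replicate_succ,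
          List.head?_cons, List.tail_cons]
        refine wp_push.2 (wp.mono (ih _ (by simp)) ?_)
        simp only [ne_eq, reduceCtorEq, not_false_eq_true, update_of_ne, update_self]
        rintro t r S' ⟨ht, ⟨rfl, p, u, hp, rfl, rfl⟩ | ⟨rfl, hw⟩⟩
        · refine ⟨by omega, .inl ⟨rfl, p + 1, u, by omega, by simp [List.replicate_succ], ?_⟩⟩
          funext k
          cases k <;> simp [List.replicate_succ']
        · refine ⟨by omega, .inr ⟨rfl, ?_⟩⟩
          rintro (_ | p) u hp
          · simp
          · simp only [List.replicate_succ, List.cons_append, List.cons.injEq, true_and]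
            exact hw p u (by omega)
      | sep =>
        refine wp_exit.2 ⟨by omega, .inl ⟨rfl, 0, w, by omega, rfl, ?_⟩⟩
        funext k
        cases k <;> simp [hS]
      | _ => exact wp_exit.2 ⟨by omega, .inr ⟨rfl, fun p u _ => ne_index (by simp) (by simp) _ _ _⟩⟩

/-- Read the index of a proposition, and replace the entry of `zer` at this index by a one. The
result is put on `vec`. -/
def readMask : Program :=
  readIndex ;;
  .pop .zer (fun
    | none => .exit .rej
    | some _ => .push .vec2 .one) ;;
  move .zer .vec2 ;;
  move .vec2 .vec

/-- Read the index of a proposition, and put the column for the proposition on `out`. -/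
def readColumn : Program :=
  readMask ;;
  sweep (fun _ a _ => a) (fun a => decide (a = .one)) .lab ;;
  moveMap (fun _ => .zero) .vec .zer

/-- A row with a one at the position `p`, followed by `q` zeros. -/
def mask (p q : ℕ) : List Sym := List.replicate p .zero ++ .one :: List.replicate q .zero

theorem length_mask (p q : ℕ) : (mask p q).length = p + 1 + q := by
  simp [mask]
  omega

/-- The one takes the place of a further zero, which exists only if the index is less than `m`. The
last move reverses the list, so that the mask is in the order of the labeling rows. -/
theorem wp_readMask (S : Stacks) (hz : S .zer = List.replicate m .zero) (h2 : S .vec2 = [])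
    (hv : S .vec = []) :
    wp readMask S fun t r S' => t ≤ 7 * m + 20 ∧
      ((r = .next ∧ ∃ p q u, m = p + 1 + q ∧ S .inp = List.replicate p .one ++ Sym.sep :: u ∧
        S' = update (update (update S .inp u) .zer []) .vec (mask p q)) ∨
      (r = .rej ∧ ∀ p u, p < m → S .inp ≠ List.replicate p .one ++ Sym.sep :: u)) := by
  refine wp_seq.2 (wp.mono (wp_readIndex m _ hz) ?_)
  rintro t r S' ⟨ht, ⟨rfl, p, u, hp, hu, rfl⟩ | ⟨rfl, hw⟩⟩
  · rcases Nat.lt_or_eq_of_le hp with hp | rfl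
    · obtain ⟨q, rfl⟩ : ∃ q, m = p + 1 + q := ⟨m - (p + 1), by omega⟩
      have hq : p + 1 + q - p = q + 1 := by omega
      refine wp.mono (Ends.seq (ends_pop (o := some .zero) (l := List.replicate q .zero)
        (by simp [hq, List.replicate_succ]) (by simp [hq, List.replicate_succ]) (ends_push _ _))
        ((ends_move (k := Var.zer) (k' := Var.vec2) (by simp) _).seq
        (ends_move (k := Var.vec2) (k' := Var.vec) (by simp) _))) ?_
      rintro t' r S' ⟨ht', rfl, rfl⟩
      simp only [ne_eq, reduceCtorEq, not_false_eq_true, update_of_ne, update_self, h2,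
        List.append_nil, List.length_append, List.length_reverse, List.length_replicate,
        List.length_cons] at ht'
      refine ⟨by omega, .inl ⟨rfl, p, q, u, rfl, hu, ?_⟩⟩
      funext k
      cases k <;> simp [h2, hv, mask]
    · refine wp.mono (Rejects.seq (rejects_pop (o := none) (l := []) (by simp) (by simp)
        rejects_exit)) ?_
      rintro t' r S' ⟨ht', rfl⟩
      refine ⟨by omega, .inr ⟨rfl, fun q v hq h => ?_⟩⟩
      rw [hu] at h
      obtain ⟨h, -⟩ := row_append_inj
        (fun b hb => by rw [List.eq_of_mem_replicate hb]; rfl)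
        (fun b hb => by rw [List.eq_of_mem_replicate hb]; rfl) h
      have := congrArg List.length h
      simp only [List.length_replicate] at this
      omega
  · exact ⟨by omega, .inr ⟨rfl, fun p u hp => hw p u hp.le⟩⟩

theorem selected_mask (p q : ℕ) (row : List Sym) (hrow : row.length = p + 1 + q) :
    selected (fun a => decide (a = .one)) (mask p q) row = [row[p]'(by omega)] := by
  induction p generalizing row with
  | zero =>
    obtain ⟨b, row, rfl⟩ := List.exists_cons_of_length_eq_add_one (n := q) (hrow.trans (by omega))
    have : ∀ q (row : List Sym),
        selected (fun a => decide (a = .one)) (List.replicate q .zero) row = [] := by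
      intro q
      induction q with
      | zero => intro row; rfl
      | succ q ih =>
        rintro (_ | ⟨b, row⟩)
        · rfl
        · simpa [selected, List.replicate_succ] using ih row
    simpa [selected, mask] using this q row
  | succ p ih =>
    obtain ⟨b, row, rfl⟩ := List.exists_cons_of_length_eq_add_one (n := p + 1 + q)
      (hrow.trans (by omega))
    have := ih row (by simp only [List.length_cons] at hrow; omega)
    simpa [selected, mask, List.replicate_succ] using this

theorem zipWith_left (v row : List Sym) (h : row.length = v.length) :
    v.zipWith (fun a _ => a) row = v := by
  induction v generalizing row with
  | nil => rfl
  | cons a v ih =>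
    obtain ⟨b, row, rfl⟩ := List.exists_cons_of_length_eq_add_one h
    simpa using ih row (by simpa using h)

theorem sweepResult_mask {ι : Type*} {t : ι → Sym} {row : ι → List Sym} {p q : ℕ} (l : List ι)
    (hl : ∀ i, (row i).length = p + 1 + q) (o : List Sym) :
    sweepResult (fun _ a _ => a) (fun a => decide (a = .one)) t row l (mask p q) o =
      (mask p q, (l.map fun i => (row i)[p]'(by rw [hl]; omega)).reverse ++ o) := by
  induction l generalizing o with
  | nil => rfl
  | cons i l ih =>
    rw [sweepResult, zipWith_left _ _ (by rw [hl, length_mask]), selected_mask p q _ (hl i), ih]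
    simp

/-- The sweep leaves the mask unchanged and collects one entry per row, the one under the mask.
Turning the mask into zeros then restores `zer`. The symbol `prop` in front of `u` has already been
read. -/
theorem wp_readColumn (W : KripkeStructure (Fin n) (Fin m)) (u : List Sym)
    (Ts : List (Set (Fin n))) (T : Set (Fin n)) (E : List Sym) {N : ℕ} (hn : n ≤ N) (hm : m ≤ N) :
    wp readColumn (litStacks W u Ts T E) fun t r S' => t ≤ 40 * (N + 1) ^ 2 ∧
      ((r = .next ∧ ∃ (p : Fin m) (u' : List Sym), Sym.prop :: u = codeProp p ++ u' ∧
        S' = update (litStacks W u' Ts T E) .out (column W p).reverse) ∨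
      (r = .rej ∧ ∀ (p : Fin m) u', Sym.prop :: u ≠ codeProp p ++ u')) := by
  have hcode : ∀ (p : Fin m) u', (Sym.prop :: u = codeProp p ++ u' ↔
      u = List.replicate p .one ++ Sym.sep :: u') := by simp [codeProp]
  simp only [ne_eq, hcode]
  have hsq : (N + 1) ^ 2 = N * N + 2 * N + 1 := by ring
  refine wp_seq.2 (wp.mono (wp_readMask (m := m) _ (by simp [litStacks, modelStacks])
    (by simp [litStacks, modelStacks]) (by simp [litStacks, modelStacks])) ?_)
  have hinp : litStacks W u Ts T E .inp = u := by simp [litStacks, modelStacks]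
  rw [hinp]
  rintro t r S' ⟨ht, ⟨rfl, p, q, u', rfl, hu, rfl⟩ | ⟨rfl, hw⟩⟩
  · have hp : p < p + 1 + q := by omega
    have h₃ := ends_sweep (S := update (update (update (litStacks W u Ts T E) .inp u') .zer [])
      .vec (mask p q)) (f := fun _ a _ => a) (g := fun a => decide (a = .one)) (M := .lab)
      (.inr rfl) (l := List.finRange n) (t := fun i => bit (i ∈ T)) (row := labRow W)
      (v := mask p q) (by simp [litStacks, teamVec]) (by simp) (by simp [litStacks, modelStacks])
      (by simp [litStacks, modelStacks]) (by simp [litStacks, modelStacks])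
      (by simp [litStacks, modelStacks]) (fun i _ => isBit_labRow W i)
      (by simp [labRow, length_mask])
    rw [sweepResult_mask _ (by simp [labRow])] at h₃
    refine wp.mono (h₃.seq (ends_moveMap (fun _ => Sym.zero) (k := Var.vec) (k' := Var.zer)
      (by simp) _)) ?_
    rintro t' r S' ⟨ht', rfl, rfl⟩
    have hle : 12 * ((n + 1) * (p + 1 + q + 1)) ≤ 12 * (N + 1) ^ 2 := by
      rw [pow_two]
      exact Nat.mul_le_mul_left _ (Nat.mul_le_mul (by omega) (by omega))
    simp only [ne_eq, reduceCtorEq, not_false_eq_true, update_of_ne, update_self,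
      List.length_finRange, length_mask] at ht'
    refine ⟨by omega, .inl ⟨rfl, ⟨p, hp⟩, u', hu, ?_⟩⟩
    funext k
    cases k <;> simp [litStacks, modelStacks, List.map_const', length_mask, column, labRow]
  · exact ⟨by omega, .inr ⟨rfl, fun p u' => hw p u' p.2⟩⟩

/-! ### Relations between worlds as bit lists, refined proposition by proposition. -/

/-- Conjunction of bits. -/
noncomputable def andBit (a b : Sym) : Sym := bit (a = .one ∧ b = .one)

/-- Equality of bits. -/
noncomputable def eqBit (a b : Sym) : Sym := bit (a = b)

theorem bit_congr {P Q : Prop} (h : P ↔ Q) : bit P = bit Q := by rw [propext h]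

theorem bit_inj {P Q : Prop} : bit P = bit Q ↔ (P ↔ Q) := by
  refine ⟨fun h => ?_, bit_congr⟩
  rw [← bit_eq_one_iff (P := P), h, bit_eq_one_iff]

/-- The pairs of worlds, in the order in which `square` treats them. -/
def allPairs (n : ℕ) : List (Fin n × Fin n) :=
  ((List.finRange n).flatMap fun i => (List.finRange n).map fun j => (i, j)).reverse

theorem mem_allPairs (x : Fin n × Fin n) : x ∈ allPairs n := by
  simp [allPairs]

theorem length_allPairs : (allPairs n).length = n * n := by
  simp [allPairs, List.length_flatMap]

theorem square_map (op : Sym → Sym → Sym) (c : Fin n → Sym) :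
    (((List.finRange n).map c).flatMap fun a => ((List.finRange n).map c).map (op a)).reverse =
      (allPairs n).map fun x => op (c x.1) (c x.2) := by
  simp [allPairs, List.map_flatMap, List.flatMap_map, Function.comp_def]

/-- A relation between worlds as a list of bits. -/
noncomputable def pairVec (A : Fin n → Fin n → Prop) : List Sym :=
  (allPairs n).map fun x => bit (A x.1 x.2)

theorem pairVec_congr {A A' : Fin n → Fin n → Prop} (h : ∀ i j, A i j ↔ A' i j) :
    pairVec A = pairVec A' := by
  have : A = A' := by
    funext i j
    exact propext (h i j)
  rw [this]

/-- Put the pairs of worlds in the team on `pairs`. -/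
noncomputable def initPairs : Program :=
  copyMap id .team .team2 .out ;; square andBit ;; move .sq .pairs2 ;; move .pairs2 .pairs

variable (W : KripkeStructure (Fin n) (Fin m)) (u : List Sym) (Ts : List (Set (Fin n)))
  (T : Set (Fin n)) {N : ℕ}

/-- The detour over `pairs2` preserves the order of `sq`, so that `pairs` stays aligned with all
matrices computed later by `square`. -/
theorem ends_initPairs (hn : n ≤ N) :
    Ends initPairs (litStacks W u Ts T []) (30 * (N + 1) ^ 2)
      (litStacks W u Ts T (pairVec fun i j => i ∈ T ∧ j ∈ T)) := by
  have h := square_map andBit fun i => bit (i ∈ T)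
  simp only [andBit, bit_eq_one_iff] at h
  have h₁ := (ends_copyMap id (k := Var.team) (h := Var.team2) (k' := Var.out)
    (by simp) (by simp) (by simp) (litStacks W u Ts T []) (by simp [litStacks, modelStacks]))
  have h₂ := ends_square andBit (teamVec T)
    (update (litStacks W u Ts T []) .out (teamVec T).reverse) (by simp)
    (by simp [litStacks, modelStacks]) (by simp [litStacks, modelStacks])
    (by simp [litStacks, modelStacks]) (by simp [litStacks, modelStacks])
  have h₁' := h₁.congr le_rfl (S₂ := update (litStacks W u Ts T []) .out (teamVec T).reverse)
    (by simp [litStacks, modelStacks])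
  refine (h₁'.seq (h₂.seq ((ends_move (k := Var.sq) (k' := Var.pairs2) (by simp) _).seq
    (ends_move (k := Var.pairs2) (k' := Var.pairs) (by simp) _)))).congr ?_ ?_
  · have hl : ((teamVec T).flatMap fun a => (teamVec T).map (andBit a)).length = n * n := by
      simp [teamVec, List.length_flatMap, Function.comp_def]
    simp only [ne_eq, reduceCtorEq, not_false_eq_true, update_of_ne, update_self,
      List.length_append, List.length_reverse, hl]
    simp [litStacks, modelStacks, teamVec]
    nlinarith
  · funext k
    cases k <;> simp [litStacks, modelStacks]
    simp only [teamVec, pairVec] at h ⊢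
    rw [← h]

/-- Read a proposition, and put the values of `g` for its values at all pairs of worlds on `sq`. -/
noncomputable def readSquare (g : Sym → Sym → Sym) : Program := readColumn ;; square g

theorem wp_readSquare (g : Sym → Sym → Sym) (E : List Sym) (hn : n ≤ N) (hm : m ≤ N) :
    wp (readSquare g) (litStacks W u Ts T E) fun t r S' => t ≤ 50 * (N + 1) ^ 2 ∧
      ((r = .next ∧ ∃ (p : Fin m) (u' : List Sym), Sym.prop :: u = codeProp p ++ u' ∧
        S' = update (litStacks W u' Ts T E) .sq ((allPairs n).map fun x =>
          g (bit (p ∈ W.label x.1)) (bit (p ∈ W.label x.2)))) ∨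
      (r = .rej ∧ ∀ (p : Fin m) u', Sym.prop :: u ≠ codeProp p ++ u')) := by
  refine wp_seq.2 (wp.mono (wp_readColumn W u Ts T E hn hm) ?_)
  rintro t r S' ⟨ht, ⟨rfl, p, u', hu, rfl⟩ | ⟨rfl, hw⟩⟩
  · refine wp.mono (ends_square g (column W p) _ (by simp)
      (by simp [litStacks, modelStacks]) (by simp [litStacks, modelStacks])
      (by simp [litStacks, modelStacks]) (by simp [litStacks, modelStacks])) ?_
    rintro t' r S' ⟨ht', rfl, rfl⟩
    have hl : (column W p).length = n := by simp [column]
    have hle : (n + 1) ^ 2 ≤ (N + 1) ^ 2 := Nat.pow_le_pow_left (by omega) 2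
    rw [hl] at ht'
    refine ⟨by omega, .inl ⟨rfl, p, u', hu, ?_⟩⟩
    rw [column, square_map]
    funext k
    cases k <;> simp [litStacks, modelStacks]
  · exact ⟨by omega, .inr ⟨rfl, hw⟩⟩

/-- Read a proposition, and keep only the pairs of worlds that agree on it. -/
noncomputable def refineByProp : Program :=
  readSquare eqBit ;; refinePairs fun e x => some (andBit e x)

theorem wp_refineByProp (A : Fin n → Fin n → Prop) (hn : n ≤ N) (hm : m ≤ N) :
    wp refineByProp (litStacks W u Ts T (pairVec A)) fun t r S' => t ≤ 60 * (N + 1) ^ 2 ∧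
      ((r = .next ∧ ∃ (p : Fin m) (u' : List Sym), Sym.prop :: u = codeProp p ++ u' ∧
        S' = litStacks W u' Ts T
          (pairVec fun i j => A i j ∧ (p ∈ W.label i ↔ p ∈ W.label j))) ∨
      (r = .rej ∧ ∀ (p : Fin m) u', Sym.prop :: u ≠ codeProp p ++ u')) := by
  refine wp_seq.2 (wp.mono (wp_readSquare W u Ts T eqBit (pairVec A) hn hm) ?_)
  rintro t r S' ⟨ht, ⟨rfl, p, u', hu, rfl⟩ | ⟨rfl, hw⟩⟩
  · refine wp.mono (ends_refinePairs (f := fun e x => some (andBit e x)) (l := allPairs n)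
      (e := fun x => bit (A x.1 x.2))
      (x := fun x => eqBit (bit (p ∈ W.label x.1)) (bit (p ∈ W.label x.2)))
      (y := fun x => bit (A x.1 x.2 ∧ (p ∈ W.label x.1 ↔ p ∈ W.label x.2)))
      (by simp) (by simp [litStacks, pairVec]) (by simp [litStacks, modelStacks]) ?_) ?_
    · simp [andBit, eqBit, bit_eq_one_iff, bit_inj]
    · rintro t' r S' ⟨ht', rfl, rfl⟩
      have hle : n * n ≤ N * N := Nat.mul_le_mul hn hn
      have hsq : (N + 1) ^ 2 = N * N + 2 * N + 1 := by ring
      rw [length_allPairs] at ht'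
      refine ⟨by omega, .inl ⟨rfl, p, u', hu, ?_⟩⟩
      funext k
      cases k <;> simp [litStacks, modelStacks, pairVec]
  · exact ⟨by omega, .inr ⟨rfl, hw⟩⟩

/-- The filter for the final check of a literal. -/
def implies (e x : Sym) : Option Sym := if e = .one ∧ x ≠ .one then none else some e

/-- Read a proposition, and check that `g` holds for its values at all pairs of worlds on
`pairs`. -/
noncomputable def checkProp (g : Sym → Sym → Sym) : Program :=
  readSquare g ;; refinePairs implies ;; clear .pairs ;; clear .team

/-- The filter `implies` has no value exactly at a marked pair that violates `g`, so the pass over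
`pairs` gets through if and only if the condition holds. The proposition read is unique, hence
failure for it excludes all readings. -/
theorem wp_checkProp (g : Sym → Sym → Sym) (A : Fin n → Fin n → Prop) (hn : n ≤ N) (hm : m ≤ N) :
    wp (checkProp g) (litStacks W u Ts T (pairVec A)) fun t r S' => t ≤ 70 * (N + 1) ^ 2 ∧
      ((r = .next ∧ ∃ (p : Fin m) (u' : List Sym), Sym.prop :: u = codeProp p ++ u' ∧
        (∀ i j, A i j → g (bit (p ∈ W.label i)) (bit (p ∈ W.label j)) = .one) ∧
        S' = modelStacks W u' Ts) ∨
      (r = .rej ∧ ∀ (p : Fin m) u', Sym.prop :: u = codeProp p ++ u' →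
        ¬∀ i j, A i j → g (bit (p ∈ W.label i)) (bit (p ∈ W.label j)) = .one)) := by
  have hle : n * n ≤ N * N := Nat.mul_le_mul hn hn
  have hsq : (N + 1) ^ 2 = N * N + 2 * N + 1 := by ring
  refine wp_seq.2 (wp.mono (wp_readSquare W u Ts T g (pairVec A) hn hm) ?_)
  rintro t r S' ⟨ht, ⟨rfl, p, u', hu, rfl⟩ | ⟨rfl, hw⟩⟩
  · by_cases hA : ∀ i j, A i j → g (bit (p ∈ W.label i)) (bit (p ∈ W.label j)) = .one
    · refine wp.mono ((ends_refinePairs (f := implies) (l := allPairs n)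
        (e := fun x => bit (A x.1 x.2))
        (x := fun x => g (bit (p ∈ W.label x.1)) (bit (p ∈ W.label x.2)))
        (y := fun x => bit (A x.1 x.2))
        (by simp) (by simp [litStacks, pairVec]) (by simp [litStacks, modelStacks]) ?_).seq
        ((ends_clear _).seq (ends_clear _))) ?_
      · intro x _
        simp only [implies, bit_eq_one_iff]
        rw [if_neg]
        rintro ⟨h₁, h₂⟩
        exact h₂ (hA _ _ (bit_eq_one_iff.1 h₁))
      · rintro t' r S' ⟨ht', rfl, rfl⟩
        simp only [ne_eq, reduceCtorEq, not_false_eq_true, update_of_ne, update_self,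
          List.length_map, length_allPairs] at ht'
        simp only [litStacks, ne_eq, reduceCtorEq, not_false_eq_true, update_of_ne, update_self,
          teamVec, List.length_map, List.length_finRange] at ht'
        refine ⟨by omega, .inl ⟨rfl, p, u', hu, hA, ?_⟩⟩
        funext k
        cases k <;> simp [litStacks, modelStacks]
    · refine wp.mono (Rejects.seq (rejects_refinePairs (f := implies) (l := allPairs n)
        (e := fun x => bit (A x.1 x.2))
        (x := fun x => g (bit (p ∈ W.label x.1)) (bit (p ∈ W.label x.2)))
        (by simp) (by simp [litStacks, pairVec]) ?_)) ?_
      · push Not at hA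
        obtain ⟨i, j, h₁, h₂⟩ := hA
        exact ⟨(i, j), mem_allPairs _, by simp [implies, bit_eq_one_iff, h₁, h₂]⟩
      · rintro t' r S' ⟨ht', rfl⟩
        rw [length_allPairs] at ht'
        refine ⟨by omega, .inr ⟨rfl, fun q v h => ?_⟩⟩
        rw [hu] at h
        obtain ⟨rfl, -⟩ := codeProp_append_inj h
        exact hA
  · exact ⟨by omega, .inr ⟨rfl, fun p u' h => absurd h (hw p u')⟩⟩

/-- Read a list of propositions, and keep only the pairs of worlds that agree on them. -/
noncomputable def refineByProps : Program :=
  .loop (.pop .inp fun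
    | some .prop => refineByProp
    | some .sep => .exit .brk
    | _ => .exit .rej)

/-- Induction on the input with `A` arbitrary, as the relation shrinks with each proposition. Every
proposition consumes at least one symbol, which pays for its quadratic cost. -/
theorem wp_refineByProps (A : Fin n → Fin n → Prop) (hn : n ≤ N) (hm : m ≤ N) :
    wp refineByProps (litStacks W u Ts T (pairVec A)) fun t r S' =>
      ((r = .next ∧ ∃ (ps : List (Fin m)) (u' : List Sym),
        u = ps.flatMap codeProp ++ Sym.sep :: u' ∧
        S' = litStacks W u' Ts T
          (pairVec fun i j => A i j ∧ ∀ p ∈ ps, (p ∈ W.label i ↔ p ∈ W.label j)) ∧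
        t + 62 * (N + 1) ^ 2 * u'.length ≤ 62 * (N + 1) ^ 2 * u.length) ∨
      (r = .rej ∧ t ≤ 62 * (N + 1) ^ 2 * u.length + 2 ∧
        ∀ (ps : List (Fin m)) u', u ≠ ps.flatMap codeProp ++ Sym.sep :: u')) := by
  have hC : 1 ≤ (N + 1) ^ 2 := Nat.one_le_pow _ _ (by omega)
  generalize hD : (N + 1) ^ 2 = D at hC ⊢
  induction hl : u.length using Nat.strong_induction_on generalizing u A with
  | _ l ih =>
  refine wp_loop.2 (wp_pop.2 ?_)
  have hinp : litStacks W u Ts T (pairVec A) .inp = u := by simp [litStacks, modelStacks]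
  have hupd : ∀ w, update (litStacks W u Ts T (pairVec A)) .inp w =
      litStacks W w Ts T (pairVec A) := by
    intro w
    funext k
    cases k <;> simp [litStacks, modelStacks]
  rw [hinp, hupd]
  cases u with
  | nil => exact wp_exit.2 (.inr ⟨rfl, by omega, by simp⟩)
  | cons a u =>
    subst hl
    cases a with
    | prop =>
      refine wp.mono (wp_refineByProp W u Ts T A hn hm) ?_
      rw [hD]
      rintro t r S' ⟨ht, ⟨rfl, p, u', hu, rfl⟩ | ⟨rfl, hw⟩⟩
      · have hlen : u'.length + 1 ≤ u.length := by
          have := congrArg List.length hu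
          simp [codeProp] at this
          omega
        have hmul : 62 * D * u'.length + 62 * D ≤ 62 * D * u.length := by
          rw [← Nat.mul_succ]
          exact Nat.mul_le_mul_left _ hlen
        simp only [List.length_cons, Nat.mul_succ]
        refine wp.mono (ih u'.length (by simp; omega) u' _ rfl) ?_
        rintro t' r S' (⟨rfl, ps, v, rfl, rfl, ht'⟩ | ⟨rfl, ht', hw⟩)
        · refine .inl ⟨rfl, p :: ps, v, by rw [hu]; simp, ?_, by omega⟩
          congr 1
          exact pairVec_congr fun i j => by simp [and_assoc]
        · refine .inr ⟨rfl, by omega, ?_⟩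
          rintro (_ | ⟨q, ps⟩) v h
          · simp at h
          · rw [hu, List.flatMap_cons, List.append_assoc] at h
            obtain ⟨rfl, h'⟩ := codeProp_append_inj h
            exact hw _ _ h'
      · refine .inr ⟨rfl, by simp only [List.length_cons, Nat.mul_succ]; omega, ?_⟩
        rintro (_ | ⟨q, ps⟩) v h
        · simp at h
        · rw [List.flatMap_cons, List.append_assoc] at h
          exact hw _ _ h
    | sep =>
      refine wp_exit.2 (.inl ⟨rfl, [], u, by simp, ?_, ?_⟩)
      · congr 1
        exact pairVec_congr fun i j => by simp
      · simp only [List.length_cons, Nat.mul_succ]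
        omega
    | _ =>
      refine wp_exit.2 (.inr ⟨rfl, by omega, ?_⟩)
      rintro (_ | ⟨q, ps⟩) v h
      · simp at h
      · simp [codeProp] at h

end MDL

/-! ### Evaluating literals and computing teams. -/

namespace MDL

open StackProgram

variable {n m : ℕ}

/-- Evaluate the literal given by the proposition that is read next and by `g`. -/
noncomputable def literal (g : Sym → Sym → Sym) : Program := initPairs ;; checkProp g

/-- Evaluate the dependence atom that is read next, where `g` describes the condition on the values
of the last proposition for two worlds that agree on the other propositions. -/
noncomputable def depLiteral (g : Sym → Sym → Sym) : Program :=
  initPairs ;; refineByProps ;; .pop .inp (fun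
    | some .prop => checkProp g
    | _ => .exit .rej)

/-- Move the uppermost team from `teams` to `team`. -/
def loadTeam : Program :=
  .loop (.pop .teams fun
    | none => .exit .rej
    | some .sep => .exit .brk
    | some b => .push .team b)

/-- Put two copies of the current team on `teams`. -/
def duplicateTeam : Program :=
  .push .teams .sep ;; copyMap id .team .team2 .teams ;; .push .teams .sep ;; move .team .teams

/-- Put the team of the successors of the current team on `teams`. -/
noncomputable def successorTeam : Program :=
  copyMap (fun _ => .zero) .team .team2 .vec ;; sweep orAnd (fun _ => false) .rel ;;
    clear .team ;; .push .teams .sep ;; move .vec .teams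

/-- The condition for a negated proposition. -/
noncomputable def notBit (a _ : Sym) : Sym := bit (a ≠ .one)

section Specs

variable (W : KripkeStructure (Fin n) (Fin m)) (u : List Sym) (Ts : List (Set (Fin n)))
  (T : Set (Fin n)) {N : ℕ}

theorem wp_literal (g : Sym → Sym → Sym) (hn : n ≤ N) (hm : m ≤ N) :
    wp (literal g) (litStacks W u Ts T []) fun t r S' => t ≤ 100 * (N + 1) ^ 2 ∧
      ((r = .next ∧ ∃ (p : Fin m) (u' : List Sym), Sym.prop :: u = codeProp p ++ u' ∧
        (∀ i j, i ∈ T ∧ j ∈ T → g (bit (p ∈ W.label i)) (bit (p ∈ W.label j)) = .one) ∧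
        S' = modelStacks W u' Ts) ∨
      (r = .rej ∧ ∀ (p : Fin m) u', Sym.prop :: u = codeProp p ++ u' →
        ¬∀ i j, i ∈ T ∧ j ∈ T → g (bit (p ∈ W.label i)) (bit (p ∈ W.label j)) = .one)) := by
  refine (ends_initPairs W u Ts T hn).wp_seq fun t ht =>
    wp.mono (wp_checkProp W u Ts T g _ hn hm) ?_
  rintro t' r S' ⟨ht', h⟩
  exact ⟨by omega, h⟩

/-- The list of propositions is paid per symbol; the summand with `110` covers the initial pairs
(`30`), the final check (`70`) and the remaining single steps. -/
theorem wp_depLiteral (g : Sym → Sym → Sym) (hn : n ≤ N) (hm : m ≤ N) :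
    wp (depLiteral g) (litStacks W u Ts T []) fun t r S' =>
      ((r = .next ∧ ∃ (ps : List (Fin m)) (q : Fin m) (u' : List Sym),
        Sym.dep :: u = codeDep ps q ++ u' ∧
        (∀ i j, (i ∈ T ∧ j ∈ T) ∧ (∀ p ∈ ps, (p ∈ W.label i ↔ p ∈ W.label j)) →
          g (bit (q ∈ W.label i)) (bit (q ∈ W.label j)) = .one) ∧
        S' = modelStacks W u' Ts ∧
        t + 62 * (N + 1) ^ 2 * u'.length ≤ 62 * (N + 1) ^ 2 * u.length + 110 * (N + 1) ^ 2) ∨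
      (r = .rej ∧ t ≤ 62 * (N + 1) ^ 2 * u.length + 110 * (N + 1) ^ 2 ∧
        ∀ (ps : List (Fin m)) (q : Fin m) u', Sym.dep :: u = codeDep ps q ++ u' →
        ¬∀ i j, (i ∈ T ∧ j ∈ T) ∧ (∀ p ∈ ps, (p ∈ W.label i ↔ p ∈ W.label j)) →
          g (bit (q ∈ W.label i)) (bit (q ∈ W.label j)) = .one)) := by
  have hC : 1 ≤ (N + 1) ^ 2 := Nat.one_le_pow _ _ (by omega)
  refine (ends_initPairs W u Ts T hn).wp_seq fun t ht => wp_seq.2 (wp.mono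
    (wp_refineByProps W u Ts T _ hn hm) ?_)
  rintro t' r S' (⟨rfl, ps, v, rfl, rfl, ht'⟩ | ⟨rfl, ht', hw⟩)
  · refine wp_pop.2 ?_
    have hinp : ∀ v E, litStacks W v Ts T E .inp = v := by simp [litStacks, modelStacks]
    have hupd : ∀ v w E, update (litStacks W v Ts T E) .inp w = litStacks W w Ts T E := by
      intro v w E
      funext k
      cases k <;> simp [litStacks, modelStacks]
    rw [hinp, hupd]
    cases v with
    | nil =>
      refine wp_exit.2 (.inr ⟨rfl, by simp only [List.length_nil] at ht'; omega, ?_⟩)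
      intro ps' q u' h
      simp only [codeDep, List.cons_append, List.append_assoc, List.cons.injEq, true_and] at h
      have := (codeProps_append_inj h).2
      simp [codeProp] at this
    | cons a v =>
      simp only [List.length_cons, Nat.mul_succ] at ht'
      simp only [List.head?_cons, List.tail_cons]
      cases a with
      | prop =>
        refine wp.mono (wp_checkProp W v Ts T g _ hn hm) ?_
        rintro t'' r S' ⟨ht'', ⟨rfl, q, u', hu, hA, rfl⟩ | ⟨rfl, hw⟩⟩
        · have hlen : u'.length ≤ v.length := by
            have := congrArg List.length hu
            simp [codeProp] at this
            omega
          have hmul := Nat.mul_le_mul_left (62 * (N + 1) ^ 2) hlen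
          exact .inl ⟨rfl, ps, q, u', by simp [codeDep, hu], hA, rfl, by omega⟩
        · refine .inr ⟨rfl, by omega, fun ps' q u' h => ?_⟩
          simp only [codeDep, List.cons_append, List.append_assoc, List.cons.injEq,
            true_and] at h
          obtain ⟨rfl, h'⟩ := codeProps_append_inj h
          exact hw q u' h'
      | _ =>
        refine wp_exit.2 (.inr ⟨rfl, by omega, ?_⟩)
        intro ps' q u' h
        simp only [codeDep, List.cons_append, List.append_assoc, List.cons.injEq, true_and] at h
        have := (codeProps_append_inj h).2
        simp [codeProp] at this
  · refine .inr ⟨rfl, by omega, fun ps q u' h => ?_⟩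
    simp only [codeDep, List.cons_append, List.append_assoc, List.cons.injEq, true_and] at h
    exact absurd h (hw _ _)

theorem ends_loadTeam_loop {row l : List Sym} {S : Stacks} (hrow : ∀ b ∈ row, b.isBit)
    (hS : S .teams = row ++ Sym.sep :: l) :
    Ends loadTeam S (2 * row.length + 2)
      (update (update S .teams l) .team (row.reverse ++ S .team)) := by
  induction row generalizing S with
  | nil =>
    refine wp_loop.2 (wp_pop.2 ?_)
    rw [hS]
    refine wp_exit.2 ⟨by simp, rfl, ?_⟩
    funext k
    cases k <;> simp
  | cons a row ih =>
    refine (Ends.loop (ends_pop (B := 1) (o := some a) (l := row ++ Sym.sep :: l)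
      (S₁ := update (update S .teams (row ++ Sym.sep :: l)) .team (a :: S .team))
      (by simp [hS]) (by simp [hS]) ?_)
      (ih (fun b hb => hrow b (List.mem_cons_of_mem _ hb)) (by simp))).congr ?_ ?_
    · have ha := hrow a List.mem_cons_self
      have : Ends (.push .team a : Program) (update S .teams (row ++ Sym.sep :: l)) 1
          (update (update S .teams (row ++ Sym.sep :: l)) .team (a :: S .team)) :=
        (ends_push _ _).congr le_rfl (by simp)
      cases a <;> first | exact this | exact absurd ha (by decide)
    · simp only [List.length_cons]
      omega
    · funext k
      cases k <;> simp

theorem ends_loadTeam :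
    Ends loadTeam (modelStacks W u (T :: Ts)) (2 * n + 2) (litStacks W u Ts T []) := by
  refine (ends_loadTeam_loop (row := (teamVec T).reverse) (l := modelStacks W u Ts .teams)
    ?_ ?_).congr ?_ ?_
  · simp [teamVec, isBit_bit]
  · simp [modelStacks]
  · simp [teamVec]
  · funext k
    cases k <;> simp [litStacks, modelStacks]

theorem rejects_loadTeam : Rejects loadTeam (modelStacks W u []) 2 :=
  wp_loop.2 (wp_pop.2 (wp_exit.2 ⟨by simp, rfl⟩))

theorem ends_duplicateTeam :
    Ends duplicateTeam (litStacks W u Ts T []) (7 * n + 8) (modelStacks W u (T :: T :: Ts)) := by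
  refine ((ends_push _ _).seq ((ends_copyMap id (k := Var.team) (h := Var.team2) (k' := Var.teams)
    (by simp) (by simp) (by simp) _ (by simp [litStacks, modelStacks])).seq
    ((ends_push _ _).seq (ends_move (k := Var.team) (k' := Var.teams) (by simp) _)))).congr ?_ ?_
  · simp [litStacks, teamVec]
    omega
  · funext k
    cases k <;> simp [litStacks, modelStacks]

/-- A Boolean product of the team vector with the relation matrix: the row of each member of `T` is
added by disjunction to the accumulator `A`, which is therefore arbitrary in the induction. -/
theorem sweepResult_successors (l : List (Fin n)) (A : Fin n → Prop) :
    (sweepResult orAnd (fun _ => false) (fun i => bit (i ∈ T)) (relRow W) l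
      ((List.finRange n).map fun j => bit (A j)) []).1 =
        (List.finRange n).map fun j => bit (A j ∨ ∃ i ∈ l, i ∈ T ∧ W.rel i j) := by
  induction l generalizing A with
  | nil => simp [sweepResult]
  | cons i l ih =>
    have : ((List.finRange n).map fun j => bit (A j)).zipWith (orAnd (bit (i ∈ T))) (relRow W i) =
        (List.finRange n).map fun j => bit (A j ∨ i ∈ T ∧ W.rel i j) := by
      simp [relRow, List.zipWith_map, orAnd, bit_eq_one_iff, List.zipWith_self]
    simp only [sweepResult, selected, this]
    simp only [List.mem_cons, exists_eq_or_imp, ← or_assoc]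
    simpa using ih _

theorem ends_successorTeam (hn : n ≤ N) :
    Ends successorTeam (litStacks W u Ts T []) (30 * (N + 1) ^ 2)
      (modelStacks W u ({j | ∃ i ∈ T, W.rel i j} :: Ts)) := by
  -- The zero vector is the accumulator of the empty set, in the form required by
  -- `sweepResult_successors`.
  have hzero : ((teamVec T).map fun _ => Sym.zero).reverse =
      (List.finRange n).map fun _ => bit False := by
    simp [teamVec, Function.comp_def, List.map_const', bit]
  refine ((ends_copyMap (fun _ => Sym.zero) (k := Var.team) (h := Var.team2) (k' := Var.vec)
    (by simp) (by simp) (by simp) _ (by simp [litStacks, modelStacks])).seq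
    ((ends_sweep (.inl rfl) (l := List.finRange n) (t := fun i => bit (i ∈ T)) (row := relRow W)
      (v := (List.finRange n).map fun _ => bit False)
      (by simp [litStacks, teamVec]) ?_ (by simp [litStacks, modelStacks])
      (by simp [litStacks, modelStacks]) (by simp [litStacks, modelStacks])
      (by simp [litStacks, modelStacks]) (fun i _ => isBit_relRow W i)
      (by simp [relRow])).seq ((ends_clear _).seq
      ((ends_push _ _).seq (ends_move (k := Var.vec) (k' := Var.teams) (by simp) _))))).congr ?_ ?_
  · rw [update_self, ← hzero]
    simp [litStacks, modelStacks]
  · have hle : (n + 1) * (n + 1) ≤ (N + 1) ^ 2 := by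
      rw [pow_two]
      exact Nat.mul_le_mul (by omega) (by omega)
    have hsq : (N + 1) ^ 2 = N * N + 2 * N + 1 := by ring
    have hlen := length_sweepResult (f := orAnd) (g := fun _ => false) (t := fun i => bit (i ∈ T))
      (row := relRow W) (List.finRange n) ((List.finRange n).map fun _ => bit False) []
      (by simp [relRow])
    simp only [List.map_const', List.length_finRange, List.length_replicate] at hlen
    simp [litStacks, modelStacks, teamVec, hlen]
    omega
  · have := sweepResult_successors W T (List.finRange n) fun _ => False
    simp at this
    funext k
    cases k <;> simp [litStacks, modelStacks, this, sweepResult_false_snd, teamVec]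

end Specs

/-! ### Truth of literals -/

section Sat

variable (W : KripkeStructure (Fin n) (Fin m)) (T : Set (Fin n))

/-- The diagonal pairs carry the whole condition. The form with pairs lets atoms share the checker
for dependence atoms. -/
theorem sat_atom_iff (p : Fin m) : Sat W T (.atom p) ↔
    ∀ i j, i ∈ T ∧ j ∈ T → (fun a _ => a) (bit (p ∈ W.label i)) (bit (p ∈ W.label j)) = .one := by
  simp only [Sat, bit_eq_one_iff]
  exact ⟨fun h i j hij => h i hij.1, fun h i hi => h i i ⟨hi, hi⟩⟩

theorem sat_negAtom_iff (p : Fin m) : Sat W T (.negAtom p) ↔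
    ∀ i j, i ∈ T ∧ j ∈ T → notBit (bit (p ∈ W.label i)) (bit (p ∈ W.label j)) = .one := by
  simp only [Sat, notBit, bit_eq_one_iff, ne_eq]
  exact ⟨fun h i j hij => h i hij.1, fun h i hi => h i i ⟨hi, hi⟩⟩

theorem sat_dep_iff (ps : List (Fin m)) (q : Fin m) : Sat W T (.dep ps q) ↔
    ∀ i j, (i ∈ T ∧ j ∈ T) ∧ (∀ p ∈ ps, (p ∈ W.label i ↔ p ∈ W.label j)) →
      eqBit (bit (q ∈ W.label i)) (bit (q ∈ W.label j)) = .one := by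
  have h₁ : ∀ A B : Set (Fin m), A ∩ {p | p ∈ ps} = B ∩ {p | p ∈ ps} ↔
      ∀ p ∈ ps, (p ∈ A ↔ p ∈ B) := by
    intro A B
    simp [Set.ext_iff]
  have h₂ : ∀ A B : Set (Fin m), A ∩ {q} = B ∩ {q} ↔ (q ∈ A ↔ q ∈ B) := by
    intro A B
    simp [Set.ext_iff]
  simp only [Sat, ne_eq, h₁, h₂, eqBit, bit_eq_one_iff, bit_inj]
  exact ⟨fun h i j hij => (h i hij.1.1 j hij.1.2).resolve_left fun h' => h' hij.2,
    fun h i hi j hj => or_iff_not_imp_left.2 fun h' => h i j ⟨⟨hi, hj⟩, not_not.1 h'⟩⟩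

/-- No pair passes a test that always yields zero, and every world agrees with itself, so only the
empty team survives. -/
theorem sat_negDep_iff (ps : List (Fin m)) (q : Fin m) : Sat W T (.negDep ps q) ↔
    ∀ i j, (i ∈ T ∧ j ∈ T) ∧ (∀ p ∈ ps, (p ∈ W.label i ↔ p ∈ W.label j)) →
      (fun _ _ => Sym.zero) (bit (q ∈ W.label i)) (bit (q ∈ W.label j)) = .one := by
  simp only [Sat, reduceCtorEq, imp_false]
  exact ⟨by rintro rfl i j ⟨⟨h, -⟩, -⟩; exact h, fun h => Set.eq_empty_of_forall_notMem fun i hi =>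
    h i i ⟨⟨hi, hi⟩, fun _ _ => Iff.rfl⟩⟩

end Sat

/-! ### The evaluation loop and its invariant. -/

/-- The word `w` consists of codes of formulas of the fragment `M` that are true in the teams
`Ts`. -/
def Good (W : KripkeStructure (Fin n) (Fin m)) (M : Set Op) : List (Set (Fin n)) → List Sym → Prop
  | [], w => w = []
  | T :: Ts, w => ∃ (φ : Formula (Fin m)) (u : List Sym),
      w = φ.code ++ u ∧ φ.InFragment M ∧ Sat W T φ ∧ Good W M Ts u

open Classical in
/-- Evaluate the formula whose first symbol has been read in the current team. -/
noncomputable def evalFormula (M : Set Op) : Sym → Program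
  | .prop => literal fun a _ => a
  | .neg => if Op.neg ∈ M then .pop .inp fun
      | some .prop => literal notBit
      | some .dep => if Op.dep ∈ M then depLiteral fun _ _ => .zero else .exit .rej
      | _ => .exit .rej
    else .exit .rej
  | .dep => if Op.dep ∈ M then depLiteral eqBit else .exit .rej
  | .and => if Op.and ∈ M then duplicateTeam else .exit .rej
  | .box => if Op.AX ∈ M then successorTeam else .exit .rej
  | _ => .exit .rej

/-- Evaluate the formulas on the input in the given teams. -/
noncomputable def evalFormulas (M : Set Op) : Program :=
  .loop (.pop .inp fun
    | none => .exit .brk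
    | some s => loadTeam ;; evalFormula M s) ;;
  .pop .teams (fun
    | none => .exit .next
    | some _ => .exit .rej)

section Specs

variable (W : KripkeStructure (Fin n) (Fin m)) {M : Set Op} (u : List Sym)
  (Ts : List (Set (Fin n))) (T : Set (Fin n)) {N : ℕ}

theorem good_code_append_iff (φ : Formula (Fin m)) :
    Good W M (T :: Ts) (φ.code ++ u) ↔ φ.InFragment M ∧ Sat W T φ ∧ Good W M Ts u := by
  refine ⟨?_, fun h => ⟨φ, u, rfl, h⟩⟩
  rintro ⟨ψ, v, h, h'⟩
  obtain ⟨rfl, rfl⟩ := Formula.code_append_inj h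
  exact h'

/-- The possible results of the evaluation of a formula, when the task was to evaluate the formulas
coded by `w` in the teams `Ts`. -/
def StepPost (W : KripkeStructure (Fin n) (Fin m)) (M : Set Op) (Ts : List (Set (Fin n)))
    (w : List Sym) (C t : ℕ) (r : Outcome) (S' : Stacks) : Prop :=
  (r = .next ∧ ∃ u Ts', S' = modelStacks W u Ts' ∧ (Good W M Ts w ↔ Good W M Ts' u) ∧
    t + C * u.length ≤ C * w.length) ∨
  (r = .rej ∧ ¬Good W M Ts w ∧ t ≤ C * w.length)

theorem stepPost_of_reject {Ts : List (Set (Fin n))} {w : List Sym} {C t : ℕ} {S' : Stacks}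
    (h : ¬Good W M Ts w) (ht : t ≤ C * w.length) : StepPost W M Ts w C t .rej S' :=
  .inr ⟨rfl, h, ht⟩

/-- Here `pre` is the part of the literal read before `prop`, empty or `neg`, so that one proof
covers both signs. The extra `40 * (N + 1) ^ 2` is slack for the steps of the surrounding programs.
-/
theorem wp_evalFormula_literal {g : Sym → Sym → Sym} {F : Fin m → Formula (Fin m)}
    {pre : List Sym} (hn : n ≤ N) (hm : m ≤ N) (hF : ∀ p, (F p).code = pre ++ codeProp p)
    (hM : ∀ p, (F p).InFragment M)
    (hsat : ∀ p, Sat W T (F p) ↔ ∀ i j, i ∈ T ∧ j ∈ T →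
      g (bit (p ∈ W.label i)) (bit (p ∈ W.label j)) = .one)
    (hpre : ∀ (φ : Formula (Fin m)) v, φ.InFragment M → pre ++ Sym.prop :: u = φ.code ++ v →
      ∃ p, φ = F p) :
    wp (literal g) (litStacks W u Ts T []) fun t => StepPost W M (T :: Ts) (pre ++ Sym.prop :: u)
      (200 * (N + 1) ^ 2) (t + 40 * (N + 1) ^ 2) := by
  refine wp.mono (wp_literal W u Ts T g hn hm) ?_
  rintro t r S' ⟨ht, ⟨rfl, p, u', hu, hA, rfl⟩ | ⟨rfl, hw⟩⟩
  · have hlen : u'.length ≤ u.length := by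
      have := congrArg List.length hu
      simp [codeProp] at this
      omega
    have hmul := Nat.mul_le_mul_left (200 * (N + 1) ^ 2) hlen
    refine .inl ⟨rfl, u', Ts, rfl, ?_, ?_⟩
    · rw [hu, ← List.append_assoc, ← hF, good_code_append_iff, hsat]
      exact ⟨fun h => h.2.2, fun h => ⟨hM p, hA, h⟩⟩
    · simp only [List.length_append, List.length_cons, ← add_assoc, Nat.mul_succ, Nat.mul_add]
      omega
  · refine stepPost_of_reject W ?_ ?_
    · rintro ⟨φ, v, h, hφ, hT, -⟩
      obtain ⟨p, rfl⟩ := hpre φ v hφ h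
      rw [hF, List.append_assoc] at h
      exact hw p v (List.append_cancel_left h) ((hsat p).1 hT)
    · simp only [List.length_append, List.length_cons, ← add_assoc, Nat.mul_succ, Nat.mul_add]
      omega

theorem wp_evalFormula_depLiteral {g : Sym → Sym → Sym}
    {F : List (Fin m) → Fin m → Formula (Fin m)}
    {pre : List Sym} (hn : n ≤ N) (hm : m ≤ N) (hF : ∀ ps q, (F ps q).code = pre ++ codeDep ps q)
    (hM : ∀ ps q, (F ps q).InFragment M)
    (hsat : ∀ ps q, Sat W T (F ps q) ↔
      ∀ i j, (i ∈ T ∧ j ∈ T) ∧ (∀ p ∈ ps, (p ∈ W.label i ↔ p ∈ W.label j)) →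
        g (bit (q ∈ W.label i)) (bit (q ∈ W.label j)) = .one)
    (hpre : ∀ (φ : Formula (Fin m)) v, φ.InFragment M → pre ++ Sym.dep :: u = φ.code ++ v →
      ∃ ps q, φ = F ps q) :
    wp (depLiteral g) (litStacks W u Ts T []) fun t =>
      StepPost W M (T :: Ts) (pre ++ Sym.dep :: u)
        (200 * (N + 1) ^ 2) (t + 40 * (N + 1) ^ 2) := by
  refine wp.mono (wp_depLiteral W u Ts T g hn hm) ?_
  -- The first part is the rate charged by `wp_depLiteral`; for the second it suffices that the
  -- input gets no longer.
  have hsplit : ∀ a, 200 * (N + 1) ^ 2 * a = 62 * (N + 1) ^ 2 * a + 138 * (N + 1) ^ 2 * a := by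
    intro a
    ring
  rintro t r S' (⟨rfl, ps, q, u', hu, hA, rfl, ht⟩ | ⟨rfl, ht, hw⟩)
  · have hlen : u'.length ≤ u.length := by
      have := congrArg List.length hu
      simp [codeDep] at this
      omega
    have hmul := Nat.mul_le_mul_left (138 * (N + 1) ^ 2) hlen
    refine .inl ⟨rfl, u', Ts, rfl, ?_, ?_⟩
    · rw [hu, ← List.append_assoc, ← hF, good_code_append_iff, hsat]
      exact ⟨fun h => h.2.2, fun h => ⟨hM ps q, hA, h⟩⟩
    · simp only [List.length_append, List.length_cons, ← add_assoc, Nat.mul_succ, Nat.mul_add]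
      rw [hsplit u.length, hsplit u'.length]
      omega
  · refine stepPost_of_reject W ?_ ?_
    · rintro ⟨φ, v, h, hφ, hT, -⟩
      obtain ⟨ps, q, rfl⟩ := hpre φ v hφ h
      rw [hF, List.append_assoc] at h
      exact hw ps q v (List.append_cancel_left h) ((hsat ps q).1 hT)
    · simp only [List.length_append, List.length_cons, ← add_assoc, Nat.mul_succ, Nat.mul_add]
      rw [hsplit u.length]
      omega

/-- For conjunction and `AX` the new list of teams is dictated by the truth definition: `T` twice,
respectively the successors of `T`. This is where `hM` enters: the remaining operators would require
a choice of teams or are simply absent from `M`, and a word that begins with one of them is no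
formula of the fragment. -/
theorem wp_evalFormula (hM : M ⊆ {Op.AX, Op.and, Op.neg, Op.dep}) (hn : n ≤ N) (hm : m ≤ N)
    (s : Sym) :
    wp (evalFormula M s) (litStacks W u Ts T []) fun t => StepPost W M (T :: Ts) (s :: u)
      (200 * (N + 1) ^ 2) (t + 20 * (N + 1) ^ 2) := by
  have hC : 1 ≤ (N + 1) ^ 2 := Nat.one_le_pow _ _ (by omega)
  have hNC : n ≤ (N + 1) ^ 2 := by nlinarith
  have htop : Op.top ∉ M := fun h => by simpa using hM h
  have hbot : Op.bot ∉ M := fun h => by simpa using hM h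
  have hor : Op.or ∉ M := fun h => by simpa using hM h
  have hcor : Op.cor ∉ M := fun h => by simpa using hM h
  have hEX : Op.EX ∉ M := fun h => by simpa using hM h
  have reject : ∀ {k : ℕ} {w : List Sym} {S : Stacks}, w ≠ [] → k ≤ 2 →
      (∀ (φ : Formula (Fin m)) v, φ.InFragment M → w ≠ φ.code ++ v) →
      wp (.exit .rej : Program) S fun t => StepPost W M (T :: Ts) w
        (200 * (N + 1) ^ 2) (t + k + 20 * (N + 1) ^ 2) := by
    intro k w S hw hk hφ
    refine wp_exit.2 (stepPost_of_reject W ?_ ?_)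
    · rintro ⟨φ, v, h, h', -⟩
      exact hφ φ v h' h
    · have : 1 ≤ w.length := List.length_pos_iff.2 hw
      nlinarith
  -- Half of the slack pays for the `k` pops that precede `p`; the other half is left for the main
  -- loop, which has to load the team.
  have weaken : ∀ {k : ℕ} {p : Program} {S : Stacks} {w : List Sym}, k ≤ 2 →
      wp p S (fun t => StepPost W M (T :: Ts) w (200 * (N + 1) ^ 2) (t + 40 * (N + 1) ^ 2)) →
      wp p S fun t => StepPost W M (T :: Ts) w (200 * (N + 1) ^ 2)
        (t + k + 20 * (N + 1) ^ 2) := by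
    intro k p S w hk h
    refine wp.mono h ?_
    rintro t r S' (⟨rfl, v, Ts', hS, hG, ht⟩ | ⟨rfl, hG, ht⟩)
    · exact .inl ⟨rfl, v, Ts', hS, hG, by omega⟩
    · exact .inr ⟨rfl, hG, by omega⟩
  have unique : ∀ {w : List Sym} {S : Stacks} {p : Program} {B : ℕ} {Ts' : List (Set (Fin n))},
      Ends p S B (modelStacks W u Ts') → B ≤ 100 * (N + 1) ^ 2 →
      (Good W M (T :: Ts) (s :: u) ↔ Good W M Ts' u) →
      wp p S fun t => StepPost W M (T :: Ts) (s :: u) (200 * (N + 1) ^ 2)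
        (t + 0 + 20 * (N + 1) ^ 2) := by
    intro w S p B Ts' h hB hG
    refine wp.mono h ?_
    rintro t r S' ⟨ht, rfl, rfl⟩
    refine .inl ⟨rfl, u, Ts', rfl, hG, ?_⟩
    rw [List.length_cons, Nat.mul_succ]
    omega
  cases s with
  | prop =>
    refine weaken (k := 0) (by omega) (wp_evalFormula_literal W u Ts T (pre := [])
      (F := .atom) hn hm (fun _ => rfl) (fun _ => trivial) (sat_atom_iff W T) ?_)
    intro φ v _ h
    cases φ <;> first
      | exact ⟨_, rfl⟩
      | simp [Formula.code, codeProp, codeDep] at h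
  | neg =>
    by_cases hneg : Op.neg ∈ M
    · simp only [evalFormula, if_pos hneg]
      refine wp_pop.2 ?_
      have hinp : litStacks W u Ts T [] .inp = u := by simp [litStacks, modelStacks]
      have hupd : ∀ v, update (litStacks W u Ts T []) .inp v = litStacks W v Ts T [] := by
        intro v
        funext k
        cases k <;> simp [litStacks, modelStacks]
      rw [hinp, hupd]
      cases u with
      | nil =>
        refine reject (k := 1) (by simp) (by omega) ?_
        intro φ v hφ h
        cases φ <;> simp [Formula.code, codeProp, codeDep] at h
      | cons a u =>
        cases a with
        | prop =>
          refine weaken (k := 1) (by omega) (wp_evalFormula_literal W u Ts T (pre := [Sym.neg])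
            (F := .negAtom) hn hm (fun _ => rfl) (fun _ => hneg) (sat_negAtom_iff W T) ?_)
          intro φ v _ h
          cases φ <;> first
            | exact ⟨_, rfl⟩
            | simp [Formula.code, codeProp, codeDep] at h
        | dep =>
          by_cases hdep : Op.dep ∈ M
          · simp only [List.head?_cons, if_pos hdep]
            refine weaken (k := 1) (by omega) (wp_evalFormula_depLiteral W u Ts T
              (pre := [Sym.neg]) (F := .negDep) hn hm (fun _ _ => rfl) (fun _ _ => ⟨hneg, hdep⟩)
              (sat_negDep_iff W T) ?_)
            intro φ v _ h
            cases φ <;> first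
              | exact ⟨_, _, rfl⟩
              | simp [Formula.code, codeProp, codeDep] at h
          · simp only [List.head?_cons, if_neg hdep]
            refine reject (k := 1) (by simp) (by omega) ?_
            intro φ v hφ h
            cases φ <;> first
              | exact hdep hφ
              | exact hdep hφ.2
              | simp [Formula.code, codeProp] at h
        | _ =>
          refine reject (k := 1) (by simp) (by omega) ?_
          intro φ v hφ h
          cases φ <;> simp [Formula.code, codeProp, codeDep] at h
    · simp only [evalFormula, if_neg hneg]
      refine reject (k := 0) (by simp) (by omega) ?_
      intro φ v hφ h
      cases φ <;> first
        | exact hneg hφ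
        | exact hneg hφ.1
        | simp [Formula.code, codeProp, codeDep] at h
  | dep =>
    by_cases hdep : Op.dep ∈ M
    · simp only [evalFormula, if_pos hdep]
      refine weaken (k := 0) (by omega) (wp_evalFormula_depLiteral W u Ts T (pre := [])
        (F := .dep) hn hm (fun _ _ => rfl) (fun _ _ => hdep) (sat_dep_iff W T) ?_)
      intro φ v _ h
      cases φ <;> first
        | exact ⟨_, _, rfl⟩
        | simp [Formula.code, codeProp, codeDep] at h
    · simp only [evalFormula, if_neg hdep]
      refine reject (k := 0) (by simp) (by omega) ?_
      intro φ v hφ h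
      cases φ <;> first
        | exact hdep hφ
        | exact hdep hφ.2
        | simp [Formula.code, codeProp] at h
  | and =>
    by_cases hand : Op.and ∈ M
    · simp only [evalFormula, if_pos hand]
      refine unique (w := u) (ends_duplicateTeam W u Ts T) (by omega) ⟨?_, ?_⟩
      · rintro ⟨φ, v, h, hφ, hT, hG⟩
        cases φ with
        | and φ ψ =>
          simp only [Formula.code, List.cons_append, List.append_assoc, List.cons.injEq,
            true_and] at h
          exact ⟨φ, _, h, hφ.2.1, hT.1, ψ, v, rfl, hφ.2.2, hT.2, hG⟩
        | _ => simp [Formula.code, codeProp, codeDep] at h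
      · rintro ⟨φ, _, rfl, hφ, hT, ψ, v, rfl, hψ, hT', hG⟩
        exact ⟨.and φ ψ, v, by simp [Formula.code], ⟨hand, hφ, hψ⟩, ⟨hT, hT'⟩, hG⟩
    · simp only [evalFormula, if_neg hand]
      refine reject (k := 0) (by simp) (by omega) ?_
      intro φ v hφ h
      cases φ <;> first
        | exact hand hφ.1
        | simp [Formula.code, codeProp, codeDep] at h
  | box =>
    by_cases hAX : Op.AX ∈ M
    · simp only [evalFormula, if_pos hAX]
      refine unique (w := u) (ends_successorTeam W u Ts T hn) (by omega) ⟨?_, ?_⟩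
      · rintro ⟨φ, v, h, hφ, hT, hG⟩
        cases φ with
        | box φ => exact ⟨φ, v, (List.cons.inj h).2, hφ.2, hT, hG⟩
        | _ => simp [Formula.code, codeProp, codeDep] at h
      · rintro ⟨φ, v, rfl, hφ, hT, hG⟩
        exact ⟨.box φ, v, by simp [Formula.code], ⟨hAX, hφ⟩, hT, hG⟩
    · simp only [evalFormula, if_neg hAX]
      refine reject (k := 0) (by simp) (by omega) ?_
      intro φ v hφ h
      cases φ <;> first
        | exact hAX hφ.1
        | simp [Formula.code, codeProp, codeDep] at h
  | _ =>
    refine reject (k := 0) (by simp) (by omega) ?_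
    intro φ v hφ h
    cases φ <;> first
      | exact htop hφ
      | exact hbot hφ
      | exact hor hφ.1
      | exact hcor hφ.1
      | exact hEX hφ.1
      | simp [Formula.code, codeProp, codeDep] at h

/-- Each round preserves `Good`. When the input is exhausted, `Good` says that no team is pending,
because codes are non-empty; if input is left but no team, `Good` fails. -/
theorem wp_evalFormulas_loop (hM : M ⊆ {Op.AX, Op.and, Op.neg, Op.dep}) (hn : n ≤ N)
    (hm : m ≤ N) :
    wp (.loop (.pop .inp fun
      | none => .exit .brk
      | some s => loadTeam ;; evalFormula M s)) (modelStacks W u Ts) fun t r S' =>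
      t ≤ 200 * (N + 1) ^ 2 * u.length + 2 ∧
      ((r = .next ∧ ∃ Ts', S' = modelStacks W [] Ts' ∧ (Good W M Ts u ↔ Ts' = [])) ∨
        (r = .rej ∧ ¬Good W M Ts u)) := by
  have hC : 1 ≤ (N + 1) ^ 2 := Nat.one_le_pow _ _ (by omega)
  have hNC : n ≤ (N + 1) ^ 2 := by nlinarith
  induction hl : u.length using Nat.strong_induction_on generalizing u Ts with
  | _ l ih =>
  subst hl
  refine wp_loop.2 (wp_pop.2 ?_)
  have hinp : modelStacks W u Ts .inp = u := rfl
  have hupd : ∀ w, update (modelStacks W u Ts) .inp w = modelStacks W w Ts := by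
    intro w
    funext k
    cases k <;> simp [modelStacks]
  rw [hinp, hupd]
  cases u with
  | nil =>
    refine wp_exit.2 ⟨by omega, .inl ⟨rfl, Ts, rfl, ?_⟩⟩
    cases Ts with
    | nil => simp [Good]
    | cons T Ts =>
      simp only [reduceCtorEq, iff_false]
      rintro ⟨φ, v, h, -⟩
      cases φ <;> simp [Formula.code, codeProp, codeDep] at h
  | cons s u =>
    have hpos : 200 * (N + 1) ^ 2 ≤ 200 * (N + 1) ^ 2 * (s :: u).length :=
      Nat.le_mul_of_pos_right _ (by simp)
    cases Ts with
    | nil =>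
      refine wp.mono (Rejects.seq (rejects_loadTeam W u)) ?_
      rintro t r S' ⟨ht, rfl⟩
      exact ⟨by omega, .inr ⟨rfl, by simp [Good]⟩⟩
    | cons T Ts =>
      refine (ends_loadTeam W u Ts T).wp_seq fun t ht =>
        wp.mono (wp_evalFormula W u Ts T hM hn hm s) ?_
      rintro t' r S' (⟨rfl, v, Ts', rfl, hG, ht'⟩ | ⟨rfl, hG, ht'⟩)
      -- The amortized time bound itself forces the input to shrink, as the slack in it is positive.
      · have hlt : v.length < (s :: u).length := by
          by_contra h
          have := Nat.mul_le_mul_left (200 * (N + 1) ^ 2) (not_lt.1 h)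
          omega
        refine wp.mono (ih _ hlt v Ts' rfl) ?_
        rintro t'' r S' ⟨ht'', h⟩
        exact ⟨by omega, by rwa [hG]⟩
      · exact ⟨by omega, .inr ⟨rfl, hG⟩⟩

theorem wp_evalFormulas (hM : M ⊆ {Op.AX, Op.and, Op.neg, Op.dep}) (hn : n ≤ N) (hm : m ≤ N) :
    wp (evalFormulas M) (modelStacks W u Ts) fun t r _ =>
      t ≤ 200 * (N + 1) ^ 2 * u.length + 4 ∧ (r = .next ↔ Good W M Ts u) := by
  refine wp_seq.2 (wp.mono (wp_evalFormulas_loop W u Ts hM hn hm) ?_)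
  rintro t r S' ⟨ht, ⟨rfl, Ts', rfl, hG⟩ | ⟨rfl, hG⟩⟩
  · refine wp_pop.2 ?_
    cases Ts' with
    | nil => exact wp_exit.2 ⟨by omega, by simp [hG]⟩
    | cons T Ts' =>
      have h : (modelStacks W [] (T :: Ts') .teams).head? ≠ none := by simp [modelStacks]
      obtain ⟨a, ha⟩ := Option.ne_none_iff_exists'.1 h
      simp only [ha]
      exact wp_exit.2 ⟨by omega, by simp [hG]⟩
  · exact ⟨by omega, by simp [hG]⟩

end Specs

/-! ### The program decides the encoded language. -/

theorem endsWorlds_code (φ : Formula (Fin m)) : EndsWorlds φ.code := by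
  cases φ <;> simp [EndsWorlds, Formula.code, codeProp, codeDep, Sym.isBit]

theorem codeInstance_eq (W : KripkeStructure (Fin n) (Fin m)) (T : Set (Fin n))
    (φ : Formula (Fin m)) : codeInstance W T φ =
      ((List.finRange n).map (worldData W T)).flatMap worldWord ++ φ.code := by
  simp [codeInstance, List.flatMap_map, worldWord_worldData]

theorem map_worldData_isBits (W : KripkeStructure (Fin n) (Fin m)) (T : Set (Fin n)) :
    ∀ x ∈ (List.finRange n).map (worldData W T), x.IsBits := by
  intro x hx
  obtain ⟨i, -, rfl⟩ := List.mem_map.1 hx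
  exact isBits_worldData W T i

theorem map_worldData_inj {n' m' : ℕ} {W : KripkeStructure (Fin n) (Fin m)} {T : Set (Fin n)}
    {W' : KripkeStructure (Fin n') (Fin m')} {T' : Set (Fin n')}
    (h : (List.finRange n).map (worldData W T) = (List.finRange n').map (worldData W' T')) :
    n = n' ∧ m = m' ∧ HEq W W' ∧ HEq T T' := by
  obtain rfl : n = n' := by simpa using congrArg List.length h
  have hi : ∀ i, worldData W T i = worldData W' T' i := by simpa using h
  -- The number of propositions can be read off only from a labeling row, so some world is needed.
  obtain ⟨i₀⟩ := W.nonempty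
  obtain rfl : m = m' := by
    simpa [worldData, labRow] using congrArg (fun x : WorldData => x.2.2.length) (hi i₀)
  simp only [worldData, relRow, labRow, Prod.mk.injEq, List.map_inj_left, List.mem_finRange,
    bit_inj, forall_const] at hi
  obtain ⟨_, R, V⟩ := W
  obtain ⟨_, R', V'⟩ := W'
  obtain rfl : R = R' := funext fun i => funext fun j => propext ((hi i).2.1 j)
  obtain rfl : V = V' := funext fun i => Set.ext fun p => (hi i).2.2 p
  obtain rfl : T = T' := Set.ext fun i => (hi i).1
  exact ⟨rfl, rfl, HEq.rfl, HEq.rfl⟩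

/-- By unique decoding the word determines the structure, the team and the remainder, so any
instance that witnesses membership is built on the same `W` and `T`. -/
theorem mem_modelChecking_iff {M : Set Op} {W : KripkeStructure (Fin n) (Fin m)}
    {T : Set (Fin n)} {u : List Sym} (hu : EndsWorlds u) :
    ((List.finRange n).map (worldData W T)).flatMap worldWord ++ u ∈ ModelChecking M ↔
      Good W M [T] u := by
  constructor
  · rintro ⟨n', m', W', T', φ, hφ, hT, h⟩
    rw [codeInstance_eq] at h
    obtain ⟨h', rfl⟩ := worldWords_append_inj (map_worldData_isBits W T)
      (map_worldData_isBits W' T') hu (endsWorlds_code φ) h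
    obtain ⟨rfl, rfl, hW, hT'⟩ := map_worldData_inj h'
    obtain rfl := eq_of_heq hW
    obtain rfl := eq_of_heq hT'
    exact ⟨φ, [], by simp, hφ, hT, rfl⟩
  · rintro ⟨φ, v, rfl, hφ, hT, rfl⟩
    exact ⟨n, m, W, T, φ, hφ, hT, by rw [codeInstance_eq, List.append_nil]⟩

/-- The word for a single world already contains a row of `n` bits and a row of `m` bits. This
allows `N` to be the length of the input. -/
theorem size_le_length (W : KripkeStructure (Fin n) (Fin m)) (T : Set (Fin n)) {w : List Sym}
    (hw : (((List.finRange n).map (worldData W T)).flatMap worldWord).length ≤ w.length) :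
    n ≤ w.length ∧ m ≤ w.length := by
  obtain ⟨i₀⟩ := W.nonempty
  have h := (length_le_flatMap _ worldWord (List.mem_map_of_mem (f := worldData W T)
    (List.mem_finRange i₀))).trans hw
  simp [worldWord, worldData, relRow, labRow] at h
  omega

/-- Decide the model checking problem for the fragment given by `M`. -/
noncomputable def modelChecker (M : Set Op) : Program :=
  readModel ;; checkShape ;; evalFormulas M

theorem wp_modelChecker {M : Set Op} (hM : M ⊆ {Op.AX, Op.and, Op.neg, Op.dep}) (w : List Sym) :
    wp (modelChecker M) (initStore .inp w) fun t r _ =>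
      t ≤ 300 * (w.length + 1) ^ 3 ∧ (r = .next ↔ w ∈ ModelChecking M) := by
  have hsq : 1 ≤ (w.length + 1) ^ 2 := Nat.one_le_pow _ _ (by omega)
  have hlin : w.length + 1 ≤ (w.length + 1) ^ 2 := Nat.le_self_pow (by omega) _
  have hcube : (w.length + 1) ^ 3 = (w.length + 1) ^ 2 * w.length + (w.length + 1) ^ 2 := by ring
  refine wp_seq.2 (wp.mono (wp_readModel w) ?_)
  rintro t r S' ⟨ht, ⟨rfl, l, u, hl, hu, hw, rfl⟩ | ⟨rfl, hw⟩⟩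
  · have hlw : (l.flatMap worldWord).length ≤ w.length := by simp [hw]
    have huw : u.length ≤ w.length := by simp [hw]
    refine wp_seq.2 (wp.mono (wp_checkShape hl hlw) ?_)
    rintro t' r S' ⟨ht', ⟨rfl, n, m, W, T, rfl, rfl⟩ | ⟨rfl, hl'⟩⟩
    · obtain ⟨hn, hm⟩ := size_le_length W T hlw
      refine wp.mono (wp_evalFormulas W u [T] hM hn hm) ?_
      rintro t'' r S' ⟨ht'', hr⟩
      have hmul := Nat.mul_le_mul_left (200 * (w.length + 1) ^ 2) huw
      refine ⟨?_, ?_⟩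
      · rw [hcube, mul_add, ← mul_assoc]
        nlinarith
      · rw [hr, ← mem_modelChecking_iff hu, ← hw]
    -- The decomposition of the input into worlds and remainder is unique, so an instance would give
    -- exactly the list that failed the shape check.
    · refine ⟨by rw [hcube]; nlinarith, ?_⟩
      simp only [reduceCtorEq, false_iff]
      rintro ⟨n, m, W, T, φ, -, -, h⟩
      rw [hw, codeInstance_eq] at h
      exact hl' n m W T (worldWords_append_inj hl (map_worldData_isBits W T) hu
        (endsWorlds_code φ) h).1
  · refine ⟨by rw [hcube]; nlinarith, ?_⟩
    simp only [reduceCtorEq, false_iff]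
    rintro ⟨n, m, W, T, φ, -, -, h⟩
    rw [codeInstance_eq] at h
    exact hw _ _ (map_worldData_isBits W T) (endsWorlds_code φ) h

end MDL

theorem theorem3p6 (M : Set MDL.Op)
    (hM : M ⊆ {MDL.Op.AX, MDL.Op.and, MDL.Op.neg, MDL.Op.dep}) :
    MDL.InP (MDL.ModelChecking M) := by
  refine StackProgram.inP_of_prog (MDL.modelChecker M) MDL.Var.inp _
    (300 * (Polynomial.X + 1) ^ 3) fun w => ?_
  simpa using MDL.wp_modelChecker hM w
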